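/- Let $r>a>0$ be coprime integers and let $X=\mathbb{C}^3_{(x,y,z)}/\frac1r(a,-a,1)=\operatorname{Spec}\mathbb{C}[x,y,z]^{\mu_r}$ be the terminal cyclic quotient singularity, where a generator of $\mu_r$ acts by $(x,y,z)\mapsto(\xi^{a}x,\xi^{-a}y,\xi z)$ with $\xi=e^{2\pi i/r}$. Let $f\colon Y\to X$ be the economic resolution, i.e. the toric morphism obtained by the weighted blow-up of the singular point with weight $\frac1r(a,r-a,1)$, followed by the same construction at the resulting cyclic quotient points, of types $\frac1a(-r,r,1)$ and $\frac1{r-a}(r,-r,1)$ (with the entries $\mp r$, $\pm r$ reduced modulo the index), until all charts are smooth. For an integer $n$ write $\overline{n}=n-\lfloor n/r\rfloor r\in\{0,\dots,r-1\}$. Then there are exactly $r-1$ prime divisors on $Y$ that are exceptional over $X$, and they can be labelled $E_1,\dots,E_{r-1}$ so that for each $i=1,\dots,r-1$: 1. the discrepancy of $E_i$ is $a(X,E_i)=\frac ir$, where $K_Y=f^*K_X+\sum_i a(X,E_i)E_i$; 2. $E_i$ corresponds to the monomial valuation with $v_i(x,y,z)=\frac1r(\overline{ia},\overline{-ia},i)$,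 that is, for every nonzero invariant polynomial $g=\sum_m c_m x^{m_1}y^{m_2}z^{m_3}\in\mathbb{C}[x,y,z]^{\mu_r}$, $$\operatorname{ord}_{E_i}(f^*g)=\min_{c_m\ne0}\ \frac1r\left(\overline{ia}\,m_1+\overline{-ia}\,m_2+i\,m_3\right).$$ -/

import Mathlib

open CategoryTheory CategoryTheory.Limits AlgebraicGeometry

noncomputable section

namespace CyclicQuotient

/-! ### The quotient `ℂ³ / (1/r)(a, -a, 1)` -/

/-- The numerical conditions on a terminal quotient singularity `(1/r)(a, -a, 1)`: `0 < a < r` and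
`a` is prime to `r` (in particular `r ≥ 2`). -/
class IsTerminalType (r a : ℕ) : Prop where
  pos : 0 < a
  lt : a < r
  coprime : Nat.Coprime a r

/-- The weights `(a, -a, 1)` of the action. -/
def weight (a : ℕ) : Fin 3 → ℤ := ![(a : ℤ), -(a : ℤ), 1]

/-- The action of the generator of the cyclic group of order `r` on `ℂ[x, y, z]`:
each coordinate is multiplied by `ξ ^ weight`, with `ξ = exp (2πi / r)`. -/
def action (r a : ℕ) : MvPolynomial (Fin 3) ℂ →ₐ[ℂ] MvPolynomial (Fin 3) ℂ :=
  MvPolynomial.aeval fun i =>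
    MvPolynomial.C (Complex.exp (2 * Real.pi * Complex.I / r) ^ weight a i) * MvPolynomial.X i

/-- The ring of invariant polynomials. -/
def invariants (r a : ℕ) : Subalgebra ℂ (MvPolynomial (Fin 3) ℂ) :=
  AlgHom.equalizer (action r a) (AlgHom.id ℂ _)

/-- The quotient `X = ℂ³ / (1/r)(a, -a, 1)`. -/
abbrev quotient (r a : ℕ) : Scheme.{0} := Spec (CommRingCat.of (invariants r a))

/-- The structure morphism of `X`. -/
abbrev structX (r a : ℕ) : quotient r a ⟶ Spec (CommRingCat.of ℂ) :=
  Spec.map (CommRingCat.ofHom (algebraMap ℂ (invariants r a)))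

/-! ### The toric charts -/

/-- The pairing of a vector of `ℚ³` with an exponent in `ℤ³`. -/
def pair (v : Fin 3 → ℚ) (m : Fin 3 → ℤ) : ℚ := ∑ i, v i * m i

/-- The lattice `M` of the exponents of invariant Laurent monomials; it is the dual of the lattice
`N = ℤ³ + ℤ (1/r)(a, -a, 1)`. -/
def latticeM (r a : ℕ) : AddSubgroup (Fin 3 → ℤ) where
  carrier := {m | (r : ℤ) ∣ ∑ i, weight a i * m i}
  zero_mem' := by simp
  add_mem' {x y} hx hy := by
    simp only [Set.mem_ofPred_eq, Pi.add_apply, mul_add, Finset.sum_add_distrib] at *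
    exact dvd_add hx hy
  neg_mem' {x} hx := by
    simp only [Set.mem_ofPred_eq, Pi.neg_apply, mul_neg, Finset.sum_neg_distrib] at *
    exact (dvd_neg).2 hx

/-- The monoid `σ^∨ ∩ M` for the cone `σ` spanned by the set `τ` of vectors. -/
def dualMonoid (r a : ℕ) (τ : Set (Fin 3 → ℚ)) : AddSubmonoid (Fin 3 → ℤ) where
  carrier := {m | m ∈ latticeM r a ∧ ∀ v ∈ τ, 0 ≤ pair v m}
  zero_mem' := ⟨zero_mem _, fun v _ => by simp [pair]⟩
  add_mem' {x y} hx hy := ⟨add_mem hx.1 hy.1, fun v hv => by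
    have : pair v (x + y) = pair v x + pair v y := by
      simp [pair, mul_add, Finset.sum_add_distrib]
    rw [this]; exact add_nonneg (hx.2 v hv) (hy.2 v hv)⟩

/-- Laurent polynomials in `x, y, z`. -/
abbrev Laurent : Type := AddMonoidAlgebra ℂ (Fin 3 → ℤ)

/-- The semigroup algebra `ℂ[σ^∨ ∩ M]`, as a subalgebra of the Laurent polynomials. -/
def chartRing (r a : ℕ) (τ : Set (Fin 3 → ℚ)) : Subalgebra ℂ Laurent where
  carrier := {f | ∀ m ∈ f.coeff.support, m ∈ dualMonoid r a τ}
  mul_mem' {f g} hf hg := by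
    intro m hm
    classical
    obtain ⟨x, hx, y, hy, rfl⟩ := Finset.mem_add.1 (AddMonoidAlgebra.support_coeff_mul_subset f g hm)
    exact add_mem (hf x hx) (hg y hy)
  add_mem' {f g} hf hg := by
    intro m hm
    classical
    rcases Finset.mem_union.1 (Finsupp.support_add hm) with h | h
    · exact hf m h
    · exact hg m h
  algebraMap_mem' c := by
    intro m hm
    have : m = 0 := by
      by_contra h
      simp [AddMonoidAlgebra.coe_algebraMap, Ne.symm h] at hm
    rw [this]; exact zero_mem _

lemma pair_add (v : Fin 3 → ℚ) (x y : Fin 3 → ℤ) : pair v (x + y) = pair v x + pair v y := by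
  simp [pair, mul_add, Finset.sum_add_distrib]

lemma pair_neg (v : Fin 3 → ℚ) (x : Fin 3 → ℤ) : pair v (-x) = - pair v x := by
  simp [pair]

lemma pair_nsmul (v : Fin 3 → ℚ) (n : ℕ) (x : Fin 3 → ℤ) : pair v (n • x) = n * pair v x := by
  simp only [pair, Finset.mul_sum]
  refine Finset.sum_congr rfl fun i _ => ?_
  simp; ring

lemma pair_zsmul (v : Fin 3 → ℚ) (n : ℤ) (x : Fin 3 → ℤ) : pair v (n • x) = n * pair v x := by
  simp only [pair, Finset.mul_sum]
  refine Finset.sum_congr rfl fun i _ => ?_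
  simp; ring

lemma single_mem {r a : ℕ} {τ : Set (Fin 3 → ℚ)} {m : Fin 3 → ℤ} (hm : m ∈ dualMonoid r a τ)
    (c : ℂ) : (AddMonoidAlgebra.single m c : Laurent) ∈ chartRing r a τ := by
  intro m' hm'
  have : m' = m := by
    by_contra h
    simp [Ne.symm h] at hm'
  rwa [this]

lemma chartRing_anti {r a : ℕ} {τ σ : Set (Fin 3 → ℚ)} (h : τ ⊆ σ) :
    chartRing r a σ ≤ chartRing r a τ :=
  fun _ hf m hm => ⟨(hf m hm).1, fun v hv => (hf m hm).2 v (h hv)⟩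

/-! ### The fan of the economic resolution -/

/-- The maximal cones of the fan obtained from a cone `⟨p, q, s⟩` of type `(1/r)(a, -a, 1)` by
repeated weighted blow-ups. If `0 < a < r`, the weighted blow-up of weight `(1/r)(a, r-a, 1)`, i.e.
the star subdivision at `w = (a p + (r-a) q + s) / r`, has the charts `⟨w, q, s⟩`, of type
`(1/a)(-r, r, 1)`, `⟨p, w, s⟩`, of type `(1/(r-a))(r, -r, 1)`, and the smooth chart `⟨p, q, w⟩`;
the first two are blown up further in the same way until they are smooth as well. -/
def maxCones (r a : ℕ) (p q s : Fin 3 → ℚ) : List ((Fin 3 → ℚ) × (Fin 3 → ℚ) × (Fin 3 → ℚ)) :=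
  if _h : 0 < a ∧ a < r then
    let w : Fin 3 → ℚ := (1 / (r : ℚ)) • ((a : ℚ) • p + ((r : ℚ) - a) • q + s)
    maxCones a ((-(r : ℤ)) % a).toNat w q s ++ maxCones (r - a) (r % (r - a)) p w s ++ [(p, q, w)]
  else [(p, q, s)]
termination_by r
decreasing_by all_goals omega

/-- The maximal cones of the economic resolution of `ℂ³ / (1/r)(a, -a, 1)`. -/
def fanMax (r a : ℕ) : List ((Fin 3 → ℚ) × (Fin 3 → ℚ) × (Fin 3 → ℚ)) :=
  maxCones r a (Pi.single 0 1) (Pi.single 1 1) (Pi.single 2 1)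

/-- The cones of the fan (each given by the set of its rays), ordered by inclusion. -/
def Fan (r a : ℕ) : Type :=
  {τ : Set (Fin 3 → ℚ) // ∃ c ∈ fanMax r a, τ ⊆ {c.1, c.2.1, c.2.2}}

instance (r a : ℕ) : PartialOrder (Fan r a) := inferInstanceAs (PartialOrder (Subtype _))

/-- The diagram of the affine toric charts `Spec ℂ[σ^∨ ∩ M]`. -/
def diagram (r a : ℕ) : Fan r a ⥤ Scheme.{0} where
  obj τ := Spec (CommRingCat.of (chartRing r a τ.1))
  map {τ σ} h := Spec.map (CommRingCat.ofHom
    (Subalgebra.inclusion (chartRing_anti (r := r) (a := a) (leOfHom h : τ.1 ⊆ σ.1))).toRingHom)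
  map_id τ := by
    rw [← Spec.map_id]; rfl
  map_comp f g := by
    rw [← Spec.map_comp]; rfl

/-- `IsCone r a r' a' p q s`: the lattice `M` is identified through `(p, q, s)` with the lattice of
exponents of the quotient `(1/r')(a', -a', 1)`. -/
structure IsCone (r a r' a' : ℕ) (p q s : Fin 3 → ℚ) : Prop where
  inj : ∀ m ∈ latticeM r a, pair p m = 0 → pair q m = 0 → pair s m = 0 → m = 0
  int : ∀ m ∈ latticeM r a, ∃ α β γ : ℤ, pair p m = α ∧ pair q m = β ∧ pair s m = γ ∧
    (r' : ℤ) ∣ a' * α - a' * β + γ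
  surj : ∀ α β γ : ℤ, (r' : ℤ) ∣ a' * α - a' * β + γ →
    ∃ m ∈ latticeM r a, pair p m = α ∧ pair q m = β ∧ pair s m = γ
  nonneg : 0 ≤ p ∧ 0 ≤ q ∧ 0 ≤ s

lemma pair_w (r' a' : ℕ) (p q s : Fin 3 → ℚ) (m : Fin 3 → ℤ) :
    pair ((1 / (r' : ℚ)) • ((a' : ℚ) • p + ((r' : ℚ) - a') • q + s)) m =
      (a' * pair p m + (r' - a') * pair q m + pair s m) / r' := by
  simp [pair, Fin.sum_univ_three]; ring

lemma isCone_start (r a : ℕ) :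
    IsCone r a r a (Pi.single 0 1) (Pi.single 1 1) (Pi.single 2 1) where
  inj m _ h0 h1 h2 := by
    simp [pair, Fin.sum_univ_three] at h0 h1 h2
    funext i; fin_cases i <;> simp [*]
  int m hm := by
    refine ⟨m 0, m 1, m 2, by simp [pair, Fin.sum_univ_three], by simp [pair, Fin.sum_univ_three],
      by simp [pair, Fin.sum_univ_three], ?_⟩
    have : (r : ℤ) ∣ ∑ i, weight a i * m i := hm
    simp only [Fin.sum_univ_three, weight, Matrix.cons_val] at this
    convert! this using 1; ring
  surj α β γ h := by
    refine ⟨![α, β, γ], ?_, by simp [pair, Fin.sum_univ_three], by simp [pair, Fin.sum_univ_three],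
      by simp [pair, Fin.sum_univ_three]⟩
    change (r : ℤ) ∣ ∑ i, weight a i * _
    simp only [Fin.sum_univ_three, weight, Matrix.cons_val]
    convert! h using 1; ring
  nonneg := ⟨by simp, by simp, by simp⟩

section step
variable {r a r' a' : ℕ} {p q s : Fin 3 → ℚ}

lemma w_nonneg (h : IsCone r a r' a' p q s) (h1 : a' < r') :
    0 ≤ (1 / (r' : ℚ)) • ((a' : ℚ) • p + ((r' : ℚ) - a') • q + s) := by
  obtain ⟨hp, hq, hs⟩ := h.nonneg
  have : (0 : ℚ) ≤ r' - a' := by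
    have : (a' : ℚ) ≤ r' := by exact_mod_cast h1.le
    linarith
  exact smul_nonneg (by positivity)
    (add_nonneg (add_nonneg (smul_nonneg (by positivity) hp) (smul_nonneg this hq)) hs)

lemma IsCone.left (h : IsCone r a r' a' p q s) (h0 : 0 < a') (h1 : a' < r') :
    IsCone r a a' ((-(r' : ℤ)) % a').toNat
      ((1 / (r' : ℚ)) • ((a' : ℚ) • p + ((r' : ℚ) - a') • q + s)) q s := by
  have hr : (r' : ℚ) ≠ 0 := by have : r' ≠ 0 := by omega
                               exact_mod_cast this
  have ha : (a' : ℚ) ≠ 0 := by exact_mod_cast h0.ne'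
  have hmod : (((-(r' : ℤ)) % a').toNat : ℤ) = -(r' : ℤ) - a' * (-(r' : ℤ) / a') := by
    rw [Int.toNat_of_nonneg (Int.emod_nonneg _ (by exact_mod_cast h0.ne')), Int.emod_def]
  refine ⟨fun m hm hw hq hs => ?_, fun m hm => ?_, fun ω β γ hd => ?_, w_nonneg h h1, h.nonneg.2⟩
  · refine h.inj m hm ?_ hq hs
    rw [pair_w, hq, hs] at hw
    field_simp at hw
    simpa [ha] using hw
  · obtain ⟨α, β, γ, hα, hβ, hγ, k, hk⟩ := h.int m hm
    have hkq : (a' : ℚ) * α - a' * β + γ = r' * k := by exact_mod_cast hk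
    refine ⟨k + β, β, γ, ?_, hβ, hγ, ?_⟩
    · rw [pair_w, hα, hβ, hγ, div_eq_iff hr]; push_cast; linear_combination hkq
    · rw [hmod]
      refine ⟨-α + β - (-(r' : ℤ) / a') * k, ?_⟩
      linear_combination hk
  · rw [hmod] at hd
    obtain ⟨k, hk⟩ := hd
    obtain ⟨m, hm, hα, hβ, hγ⟩ := h.surj (β - k - (-(r' : ℤ) / a') * (ω - β)) β γ
      ⟨ω - β, by linear_combination hk⟩
    refine ⟨m, hm, ?_, hβ, hγ⟩
    have hkq : ((-(r' : ℚ) - a' * ((-(r' : ℤ) / a' : ℤ) : ℚ)) * ω -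
      (-(r' : ℚ) - a' * ((-(r' : ℤ) / a' : ℤ) : ℚ)) * β + γ) = a' * k := by exact_mod_cast hk
    rw [pair_w, hα, hβ, hγ, div_eq_iff hr]
    push_cast
    linear_combination hkq

lemma IsCone.right (h : IsCone r a r' a' p q s) (h0 : 0 < a') (h1 : a' < r') :
    IsCone r a (r' - a') (r' % (r' - a')) p
      ((1 / (r' : ℚ)) • ((a' : ℚ) • p + ((r' : ℚ) - a') • q + s)) s := by
  have hr : (r' : ℚ) ≠ 0 := by have : r' ≠ 0 := by omega
                               exact_mod_cast this
  have hb : (r' : ℚ) - a' ≠ 0 := by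
    have : (a' : ℚ) < r' := by exact_mod_cast h1
    linarith
  obtain ⟨d, hmod⟩ : ∃ d : ℤ, ((r' % (r' - a') : ℕ) : ℤ) = r' - ((r' : ℤ) - a') * d := by
    refine ⟨((r' / (r' - a') : ℕ) : ℤ), ?_⟩
    have := Nat.div_add_mod r' (r' - a')
    zify [h1.le] at this ⊢
    linarith
  refine ⟨fun m hm hp hw hs => ?_, fun m hm => ?_, fun α ω γ hd => ?_, h.nonneg.1, w_nonneg h h1,
    h.nonneg.2.2⟩
  · refine h.inj m hm hp ?_ hs
    rw [pair_w, hp, hs] at hw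
    field_simp at hw
    simpa [hb] using hw
  · obtain ⟨α, β, γ, hα, hβ, hγ, k, hk⟩ := h.int m hm
    have hkq : (a' : ℚ) * α - a' * β + γ = r' * k := by exact_mod_cast hk
    refine ⟨α, k + β, γ, hα, ?_, hγ, ?_⟩
    · rw [pair_w, hα, hβ, hγ, div_eq_iff hr]; push_cast; linear_combination hkq
    · rw [hmod, Nat.cast_sub h1.le]
      refine ⟨α - β - d * (α - k - β), ?_⟩
      linear_combination hk
  · rw [hmod, Nat.cast_sub h1.le] at hd
    obtain ⟨k, hk⟩ := hd
    obtain ⟨m, hm, hα, hβ, hγ⟩ := h.surj α (α - k - d * (α - ω)) γ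
      ⟨ω - (α - k - d * (α - ω)), by linear_combination hk⟩
    refine ⟨m, hm, hα, ?_, hγ⟩
    have hkq : ((r' : ℚ) - (r' - a') * d) * α -
      (r' - (r' - a') * d) * ω + γ = (r' - a') * k := by
      have := congrArg (Int.cast : ℤ → ℚ) hk
      push_cast at this
      exact this
    rw [pair_w, hα, hβ, hγ, div_eq_iff hr]
    push_cast
    linear_combination hkq

lemma IsCone.top (h : IsCone r a r' a' p q s) (h1 : a' < r') :
    IsCone r a 1 0 p q ((1 / (r' : ℚ)) • ((a' : ℚ) • p + ((r' : ℚ) - a') • q + s)) := by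
  have hr : (r' : ℚ) ≠ 0 := by have : r' ≠ 0 := by omega
                               exact_mod_cast this
  refine ⟨fun m hm hp hq hw => ?_, fun m hm => ?_, fun α β ω _ => ?_, h.nonneg.1, h.nonneg.2.1,
    w_nonneg h h1⟩
  · refine h.inj m hm hp hq ?_
    rw [pair_w, hp, hq] at hw
    field_simp at hw
    simpa using hw
  · obtain ⟨α, β, γ, hα, hβ, hγ, k, hk⟩ := h.int m hm
    have hkq : (a' : ℚ) * α - a' * β + γ = r' * k := by exact_mod_cast hk
    refine ⟨α, β, k + β, hα, hβ, ?_, by simp⟩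
    rw [pair_w, hα, hβ, hγ, div_eq_iff hr]; push_cast; linear_combination hkq
  · obtain ⟨m, hm, hα, hβ, hγ⟩ := h.surj α β (r' * (ω - β) - a' * α + a' * β) ⟨ω - β, by ring⟩
    refine ⟨m, hm, hα, hβ, ?_⟩
    rw [pair_w, hα, hβ, hγ, div_eq_iff hr]; push_cast; ring

end step

/-- All maximal cones of the fan are smooth. -/
lemma isCone_of_mem {r a : ℕ} (r' a' : ℕ) (p q s : Fin 3 → ℚ) (hcop : Nat.Coprime a' r')
    (hlt : a' < r') (h : IsCone r a r' a' p q s)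
    {c : (Fin 3 → ℚ) × (Fin 3 → ℚ) × (Fin 3 → ℚ)} (hc : c ∈ maxCones r' a' p q s) :
    IsCone r a 1 0 c.1 c.2.1 c.2.2 := by
  induction r' using Nat.strong_induction_on generalizing a' p q s with
  | _ r' ih =>
  rw [maxCones] at hc
  split_ifs at hc with h01
  · obtain ⟨h0, h1⟩ := h01
    simp only [List.mem_append, List.mem_singleton] at hc
    rcases hc with (hc | hc) | hc
    · refine ih a' h1 _ _ _ _ ?_ ?_ (h.left h0 h1) hc
      · have h2 := Int.toNat_of_nonneg (Int.emod_nonneg (-(r' : ℤ)) (b := a') (by omega))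
        rw [← Nat.isCoprime_iff_coprime, h2, Int.emod_def]
        obtain ⟨u, v, e⟩ := Nat.isCoprime_iff_coprime.2 hcop
        exact ⟨-v, u - v * (-(r' : ℤ) / a'), by linear_combination e⟩
      · have := Int.emod_lt_of_pos (-(r' : ℤ)) (b := a') (by omega)
        have h2 := Int.emod_nonneg (-(r' : ℤ)) (b := a') (by omega)
        omega
    · refine ih (r' - a') (by omega) _ _ _ _ ?_ (Nat.mod_lt _ (by omega)) (h.right h0 h1) hc
      unfold Nat.Coprime
      rw [← Nat.gcd_rec]
      have h3 := (Nat.coprime_sub_self_left h1.le).2 (Nat.Coprime.symm hcop)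
      have : Nat.Coprime (r' - a') r' := by
        have h4 : r' = (r' - a') + a' := by omega
        rw [h4]; simpa using h3
      exact this
    · rw [hc]; exact h.top h1
  · have ha : a' = 0 := by omega
    subst ha
    have : r' = 1 := by simpa using hcop
    subst this
    simp only [List.mem_singleton] at hc
    rw [hc]; exact h

lemma isCone_fan {r a : ℕ} [IsTerminalType r a] {c : (Fin 3 → ℚ) × (Fin 3 → ℚ) × (Fin 3 → ℚ)}
    (hc : c ∈ fanMax r a) : IsCone r a 1 0 c.1 c.2.1 c.2.2 :=
  isCone_of_mem r a _ _ _ IsTerminalType.coprime IsTerminalType.lt (isCone_start r a) hc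

/-! ### Gluing the charts -/

lemma exists_face {r a : ℕ} [IsTerminalType r a] {τ σ : Fan r a} (_h : τ ≤ σ) :
    ∃ m ∈ latticeM r a, (∀ v ∈ τ.1, pair v m = 0) ∧ (∀ v ∈ σ.1, v ∉ τ.1 → 1 ≤ pair v m) := by
  classical
  obtain ⟨c, hc, hσ⟩ := σ.2
  obtain ⟨m, hm, h1, h2, h3⟩ := (isCone_fan hc).surj (if c.1 ∈ τ.1 then 0 else 1)
    (if c.2.1 ∈ τ.1 then 0 else 1) (if c.2.2 ∈ τ.1 then 0 else 1) (by simp)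
  refine ⟨m, hm, fun v hv => ?_, fun v hv hv' => ?_⟩
  · rcases hσ (_h hv) with rfl | rfl | rfl
    · simpa [hv] using h1
    · simpa [hv] using h2
    · simpa [hv] using h3
  · rcases hσ hv with rfl | rfl | rfl
    · simp [h1, hv']
    · simp [h2, hv']
    · simp [h3, hv']

/-- Passing to a face is the localization at a monomial. -/
lemma isLocalization_face {r a : ℕ} {τ σ : Set (Fin 3 → ℚ)} (hτσ : τ ⊆ σ) {m : Fin 3 → ℤ}
    (hm : m ∈ latticeM r a) (h0 : ∀ v ∈ τ, pair v m = 0) (h1 : ∀ v ∈ σ, v ∉ τ → 1 ≤ pair v m)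
    (hmσ : m ∈ dualMonoid r a σ) (hfin : σ.Finite) :
    letI := (Subalgebra.inclusion (chartRing_anti (r := r) (a := a) hτσ)).toRingHom.toAlgebra
    IsLocalization.Away (⟨AddMonoidAlgebra.single m 1, single_mem hmσ 1⟩ : chartRing r a σ)
      (chartRing r a τ) := by
  let _ := (Subalgebra.inclusion (chartRing_anti (r := r) (a := a) hτσ)).toRingHom.toAlgebra
  have hneg : -m ∈ dualMonoid r a τ :=
    ⟨neg_mem hm, fun v hv => by rw [pair_neg, h0 v hv]; simp⟩
  refine IsLocalization.Away.mk _ ?_ ?_ ?_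
  · refine IsUnit.of_mul_eq_one ⟨AddMonoidAlgebra.single (-m) 1, single_mem hneg 1⟩ ?_
    apply Subtype.ext
    change (AddMonoidAlgebra.single m 1 * AddMonoidAlgebra.single (-m) 1 : Laurent) = 1
    rw [AddMonoidAlgebra.single_mul_single]
    simp [AddMonoidAlgebra.one_def]
  · intro f
    obtain ⟨n, hn⟩ : ∃ n : ℕ, ∀ v ∈ σ, v ∉ τ → ∀ k ∈ f.1.coeff.support, 0 ≤ pair v k + n := by
      obtain ⟨n, hn⟩ := exists_nat_ge
        (∑ v ∈ hfin.toFinset, ∑ k ∈ f.1.coeff.support, |pair v k|)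
      refine ⟨n, fun v hv _ k hk => ?_⟩
      have h2 : |pair v k| ≤ ∑ k ∈ f.1.coeff.support, |pair v k| :=
        Finset.single_le_sum (f := fun k => |pair v k|) (fun _ _ => abs_nonneg _) hk
      have h3 : ∑ k ∈ f.1.coeff.support, |pair v k| ≤
          ∑ v ∈ hfin.toFinset, ∑ k ∈ f.1.coeff.support, |pair v k| :=
        Finset.single_le_sum (f := fun v => ∑ k ∈ f.1.coeff.support, |pair v k|)
          (fun _ _ => Finset.sum_nonneg fun _ _ => abs_nonneg _) (hfin.mem_toFinset.2 hv)
      have := neg_abs_le (pair v k)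
      linarith
    have hmem : (f.1 * AddMonoidAlgebra.single (n • m) 1 : Laurent) ∈ chartRing r a σ := by
      intro k hk
      classical
      obtain ⟨x, hx, y, hy, rfl⟩ :=
        Finset.mem_add.1 (AddMonoidAlgebra.support_coeff_mul_subset _ _ hk)
      have hy' : y = n • m := by
        by_contra h
        rw [AddMonoidAlgebra.coeff_single, Finsupp.mem_support_iff, Finsupp.single_apply,
          if_neg (Ne.symm h)] at hy
        exact hy rfl
      subst hy'
      refine ⟨add_mem (f.2 x hx).1 (nsmul_mem hm n), fun v hv => ?_⟩
      rw [pair_add, pair_nsmul]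
      by_cases hvτ : v ∈ τ
      · rw [h0 v hvτ]; simpa using (f.2 x hx).2 v hvτ
      · have := hn v hv hvτ x hx
        have h5 : (n : ℚ) * 1 ≤ n * pair v m :=
          mul_le_mul_of_nonneg_left (h1 v hv hvτ) (by positivity)
        linarith
    refine ⟨n, ⟨_, hmem⟩, ?_⟩
    apply Subtype.ext
    change (f.1 * AddMonoidAlgebra.single m 1 ^ n : Laurent) = f.1 * _
    rw [AddMonoidAlgebra.single_pow]; simp
  · intro x y hxy
    refine ⟨0, ?_⟩
    have : x.1 = y.1 := congrArg (fun g : chartRing r a τ => g.1) hxy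
    rw [Subtype.ext this]

lemma Fan.finite {r a : ℕ} (τ : Fan r a) : τ.1.Finite := by
  obtain ⟨c, -, h⟩ := τ.2
  exact Set.Finite.subset (by simp) h

lemma face_mem {r a : ℕ} {τ σ : Set (Fin 3 → ℚ)} {m : Fin 3 → ℤ}
    (hm : m ∈ latticeM r a) (h0 : ∀ v ∈ τ, pair v m = 0) (h1 : ∀ v ∈ σ, v ∉ τ → 1 ≤ pair v m) :
    m ∈ dualMonoid r a σ :=
  ⟨hm, fun v hv => by
    by_cases h : v ∈ τ
    · rw [h0 v h]
    · linarith [h1 v hv h]⟩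

instance diagram_isOpenImmersion (r a : ℕ) [IsTerminalType r a] {τ σ : Fan r a} (h : τ ⟶ σ) :
    IsOpenImmersion ((diagram r a).map h) := by
  obtain ⟨m, hm, h0, h1⟩ := exists_face (leOfHom h)
  let _ := (Subalgebra.inclusion
    (chartRing_anti (r := r) (a := a) (leOfHom h : τ.1 ⊆ σ.1))).toRingHom.toAlgebra
  have := isLocalization_face (leOfHom h : τ.1 ⊆ σ.1) hm h0 h1 (face_mem hm h0 h1) σ.finite
  exact IsOpenImmersion.of_isLocalization
    (⟨AddMonoidAlgebra.single m 1, single_mem (face_mem hm h0 h1) 1⟩ : chartRing r a σ.1)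

lemma range_diagram_map {r a : ℕ} {τ σ : Fan r a} (h : τ ⟶ σ)
    {m : Fin 3 → ℤ} (hm : m ∈ latticeM r a) (h0 : ∀ v ∈ τ.1, pair v m = 0)
    (h1 : ∀ v ∈ σ.1, v ∉ τ.1 → 1 ≤ pair v m) :
    Set.range ((diagram r a).map h) = (PrimeSpectrum.basicOpen
      (⟨AddMonoidAlgebra.single m 1, single_mem (face_mem hm h0 h1) 1⟩ : chartRing r a σ.1) :
        Set (PrimeSpectrum (chartRing r a σ.1))) := by
  let _ := (Subalgebra.inclusion
    (chartRing_anti (r := r) (a := a) (leOfHom h : τ.1 ⊆ σ.1))).toRingHom.toAlgebra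
  have := isLocalization_face (leOfHom h : τ.1 ⊆ σ.1) hm h0 h1 (face_mem hm h0 h1) σ.finite
  exact PrimeSpectrum.localization_away_comap_range (chartRing r a τ.1)
    (⟨AddMonoidAlgebra.single m 1, single_mem (face_mem hm h0 h1) 1⟩ : chartRing r a σ.1)

instance diagram_isLocallyDirected (r a : ℕ) [IsTerminalType r a] :
    (diagram r a ⋙ Scheme.forget).IsLocallyDirected where
  cond {i j k} fi fj xi xj hx := by
    change (diagram r a).map fi xi = (diagram r a).map fj xj at hx
    obtain ⟨m, hm, h0, h1⟩ := exists_face (leOfHom fi)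
    obtain ⟨n, hn, h0', h1'⟩ := exists_face (leOfHom fj)
    let l : Fan r a := ⟨i.1 ∩ j.1, by
      obtain ⟨c, hc, h⟩ := i.2
      exact ⟨c, hc, Set.inter_subset_left.trans h⟩⟩
    have hi : l ≤ i := Set.inter_subset_left
    have hj : l ≤ j := Set.inter_subset_right
    have hmn : m + n ∈ latticeM r a := add_mem hm hn
    have hik : i.1 ⊆ k.1 := leOfHom fi
    have hjk : j.1 ⊆ k.1 := leOfHom fj
    have g0 : ∀ v ∈ l.1, pair v (m + n) = 0 := fun v hv => by
      rw [pair_add, h0 v hv.1, h0' v hv.2, add_zero]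
    have g1 : ∀ v ∈ k.1, v ∉ l.1 → 1 ≤ pair v (m + n) := fun v hv hv' => by
      rw [pair_add]
      by_cases a1 : v ∈ i.1
      · rw [h0 v a1]
        linarith [h1' v hv fun h => hv' ⟨a1, h⟩]
      · have := h1 v hv a1
        have := (face_mem hn h0' h1').2 v hv
        linarith
    have e1 : (diagram r a).map fi xi ∈ Set.range ((diagram r a).map fi) := ⟨xi, rfl⟩
    have e2 : (diagram r a).map fi xi ∈ Set.range ((diagram r a).map fj) := ⟨xj, hx.symm⟩
    have e3 : (diagram r a).map fi xi ∈
        Set.range ((diagram r a).map (homOfLE (hi.trans (leOfHom fi)))) := by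
      rw [range_diagram_map fi hm h0 h1] at e1
      rw [range_diagram_map fj hn h0' h1'] at e2
      rw [range_diagram_map _ hmn g0 g1]
      have : (⟨AddMonoidAlgebra.single (m + n) 1, single_mem (face_mem hmn g0 g1) 1⟩ :
          chartRing r a k.1) = ⟨AddMonoidAlgebra.single m 1, single_mem (face_mem hm h0 h1) 1⟩ *
            ⟨AddMonoidAlgebra.single n 1, single_mem (face_mem hn h0' h1') 1⟩ := by
        apply Subtype.ext
        change _ = (AddMonoidAlgebra.single m 1 * AddMonoidAlgebra.single n 1 : Laurent)
        rw [AddMonoidAlgebra.single_mul_single]; simp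
      rw [this, PrimeSpectrum.basicOpen_mul]
      exact ⟨e1, e2⟩
    obtain ⟨x, hx'⟩ := e3
    refine ⟨l, homOfLE hi, homOfLE hj, x, ?_, ?_⟩
    · apply ((diagram r a).map fi).isOpenEmbedding.injective
      change ((diagram r a).map fi) (((diagram r a).map (homOfLE hi)) x) = _
      rw [← Scheme.Hom.comp_apply, ← Functor.map_comp]
      exact hx'
    · apply ((diagram r a).map fj).isOpenEmbedding.injective
      change ((diagram r a).map fj) (((diagram r a).map (homOfLE hj)) x) = (diagram r a).map fj xj
      rw [← Scheme.Hom.comp_apply, ← Functor.map_comp, ← hx]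
      exact hx'

/-- The economic resolution `Y` of `ℂ³ / (1/r)(a, -a, 1)`: the toric variety of the fan obtained by
repeated weighted blow-ups, glued from its affine charts along their common faces. -/
def economicResolution (r a : ℕ) [IsTerminalType r a] : Scheme.{0} := colimit (diagram r a)

/-- The inclusion of a chart. -/
def chartι (r a : ℕ) [IsTerminalType r a] (τ : Fan r a) :
    Spec (CommRingCat.of (chartRing r a τ.1)) ⟶ economicResolution r a := colimit.ι (diagram r a) τ

instance (r a : ℕ) [IsTerminalType r a] (τ : Fan r a) : IsOpenImmersion (chartι r a τ) :=
  inferInstanceAs (IsOpenImmersion (colimit.ι (diagram r a) τ))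

lemma chartι_surj (r a : ℕ) [IsTerminalType r a] (y : economicResolution r a) :
    ∃ τ x, chartι r a τ x = y :=
  Scheme.IsLocallyDirected.ι_jointly_surjective (diagram r a) y

lemma fanMax_ne_nil (r a : ℕ) : ∃ c, c ∈ fanMax r a := by
  unfold fanMax
  rw [maxCones]
  split_ifs with h
  · exact ⟨_, by simp; exact Or.inr (Or.inr rfl)⟩
  · exact ⟨_, List.mem_singleton.2 rfl⟩

/-- The cone `0`, whose chart is the torus. -/
def Fan.zero (r a : ℕ) : Fan r a :=
  ⟨∅, (fanMax_ne_nil r a).choose, (fanMax_ne_nil r a).choose_spec, Set.empty_subset _⟩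

instance (r a : ℕ) [IsTerminalType r a] : IsIntegral (economicResolution r a) := by
  have hne : ∀ τ : Fan r a, Nonempty (Spec (CommRingCat.of (chartRing r a τ.1))) := fun τ =>
    inferInstanceAs (Nonempty (PrimeSpectrum (chartRing r a τ.1)))
  have hred : IsReduced (economicResolution r a) := by
    have : ∀ i, IsReduced ((Scheme.IsLocallyDirected.openCover (diagram r a)).X i) := fun i =>
      inferInstanceAs (IsReduced (Spec (CommRingCat.of (chartRing r a i.1))))
    exact IsReduced.of_openCover _ (Scheme.IsLocallyDirected.openCover (diagram r a))
  -- the image of the torus is irreducible and dense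
  have hdense : Dense (Set.range (chartι r a (Fan.zero r a))) := by
    intro y
    obtain ⟨τ, x, rfl⟩ := chartι_surj r a y
    have hle : Fan.zero r a ≤ τ := Set.empty_subset _
    have hd : Dense (Set.range ((diagram r a).map (homOfLE hle))) := by
      have ho := ((diagram r a).map (homOfLE hle)).isOpenEmbedding.isOpen_range
      have : IrreducibleSpace ((diagram r a).obj τ) :=
        inferInstanceAs (IrreducibleSpace (Spec (CommRingCat.of (chartRing r a τ.1))))
      have hn := hne (Fan.zero r a)
      exact ho.dense (@Set.range_nonempty _ _ hn _)
    have hx := hd x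
    have h1 := image_closure_subset_closure_image (chartι r a τ).continuous ⟨x, hx, rfl⟩
    refine closure_mono ?_ h1
    rintro _ ⟨_, ⟨z, rfl⟩, rfl⟩
    refine ⟨z, ?_⟩
    have : (diagram r a).map (homOfLE hle) ≫ chartι r a τ = chartι r a (Fan.zero r a) :=
      colimit.w (diagram r a) (homOfLE hle)
    exact (congrArg (fun g => g.base z) this).symm
  have hirr : IrreducibleSpace (economicResolution r a) := by
    have h1 : IsIrreducible (Set.range (chartι r a (Fan.zero r a))) := by
      rw [← Set.image_univ]
      exact (IrreducibleSpace.isIrreducible_univ _).image _ (chartι r a _).continuous.continuousOn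
    have h2 := h1.closure
    rw [hdense.closure_eq] at h2
    exact (irreducibleSpace_def _).2 h2
  exact isIntegral_of_irreducibleSpace_of_isReduced _

lemma chartRing_fg (r a : ℕ) [IsTerminalType r a] (τ : Fan r a) : (chartRing r a τ.1).FG := by
  classical
  obtain ⟨c, hc, hτ⟩ := τ.2
  have hC := isCone_fan hc
  obtain ⟨mp, hmp, p1, p2, p3⟩ := hC.surj 1 0 0 (by simp)
  obtain ⟨mq, hmq, q1, q2, q3⟩ := hC.surj 0 1 0 (by simp)
  obtain ⟨ms, hms, s1, s2, s3⟩ := hC.surj 0 0 1 (by simp)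
  let gen : Finset (Fin 3 → ℤ) := {mp, mq, ms, -mp, -mq, -ms}
  let G : Finset Laurent :=
    (gen.filter (· ∈ dualMonoid r a τ.1)).image fun m => AddMonoidAlgebra.single m 1
  refine ⟨G, le_antisymm ?_ ?_⟩
  · rw [Algebra.adjoin_le_iff]
    intro g hg
    obtain ⟨m, hm, rfl⟩ := Finset.mem_image.1 (Finset.mem_coe.1 hg)
    exact single_mem (Finset.mem_filter.1 hm).2 1
  · intro f hf
    have key : ∀ m ∈ dualMonoid r a τ.1,
        (AddMonoidAlgebra.single m 1 : Laurent) ∈ Algebra.adjoin ℂ (G : Set Laurent) := by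
      intro m hm
      obtain ⟨α, β, γ, hα, hβ, hγ, -⟩ := hC.int m hm.1
      have hmem : ∀ n ∈ gen, n ∈ dualMonoid r a τ.1 → ∀ k : ℕ,
          (AddMonoidAlgebra.single (k • n) 1 : Laurent) ∈ Algebra.adjoin ℂ (G : Set Laurent) := by
        intro n hn hn' k
        have h1 : (AddMonoidAlgebra.single n 1 : Laurent) ∈ Algebra.adjoin ℂ (G : Set Laurent) :=
          Algebra.subset_adjoin (Finset.mem_coe.2
            (Finset.mem_image.2 ⟨n, Finset.mem_filter.2 ⟨hn, hn'⟩, rfl⟩))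
        have := pow_mem h1 k
        rwa [AddMonoidAlgebra.single_pow, one_pow] at this
      have hz : ∀ (v : Fin 3 → ℚ) (n : Fin 3 → ℤ) (k : ℤ), n ∈ gen → -n ∈ gen →
          n ∈ latticeM r a → pair v n = 1 → pair v m = k →
          (∀ u ∈ τ.1, u ≠ v → pair u n = 0) →
          (AddMonoidAlgebra.single (k • n) 1 : Laurent) ∈
            Algebra.adjoin ℂ (G : Set Laurent) := by
        intro v n k hn hn' hnM hv hk hu
        have hpos : n ∈ dualMonoid r a τ.1 := ⟨hnM, fun u huτ => by
          by_cases h : u = v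
          · rw [h, hv]; norm_num
          · rw [hu u huτ h]⟩
        rcases le_or_gt 0 k with h | h
        · have := hmem n hn hpos k.toNat
          rwa [← natCast_zsmul, Int.toNat_of_nonneg h] at this
        · have hvτ : v ∉ τ.1 := fun hvτ => by
            have := hm.2 v hvτ
            rw [hk] at this
            have : 0 ≤ k := by exact_mod_cast this
            omega
          have hneg : -n ∈ dualMonoid r a τ.1 := ⟨neg_mem hnM, fun u huτ => by
            have h : u ≠ v := fun h => hvτ (h ▸ huτ)
            rw [pair_neg, hu u huτ h]; simp⟩
          have := hmem (-n) hn' hneg (-k).toNat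
          rw [← natCast_zsmul, Int.toNat_of_nonneg (by omega)] at this
          simpa using this
      have hsum : m = α • mp + β • mq + γ • ms := by
        have : m - (α • mp + β • mq + γ • ms) = 0 := by
          have hM : m - (α • mp + β • mq + γ • ms) ∈ latticeM r a :=
            sub_mem hm.1 (add_mem (add_mem (zsmul_mem hmp _) (zsmul_mem hmq _)) (zsmul_mem hms _))
          refine hC.inj _ hM ?_ ?_ ?_ <;>
            rw [sub_eq_add_neg, pair_add, pair_neg, pair_add, pair_add, pair_zsmul, pair_zsmul,
              pair_zsmul]
          · rw [hα, p1, q1, s1]; push_cast; ring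
          · rw [hβ, p2, q2, s2]; push_cast; ring
          · rw [hγ, p3, q3, s3]; push_cast; ring
        exact sub_eq_zero.1 this
      have h1 := hz c.1 mp α (by simp [gen]) (by simp [gen]) hmp (by simpa using p1) hα
        (fun u hu hne => by
          rcases hτ hu with rfl | rfl | rfl
          · exact absurd rfl hne
          · simpa using p2
          · simpa using p3)
      have h2 := hz c.2.1 mq β (by simp [gen]) (by simp [gen]) hmq (by simpa using q2) hβ
        (fun u hu hne => by
          rcases hτ hu with rfl | rfl | rfl
          · simpa using q1
          · exact absurd rfl hne
          · simpa using q3)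
      have h3 := hz c.2.2 ms γ (by simp [gen]) (by simp [gen]) hms (by simpa using s3) hγ
        (fun u hu hne => by
          rcases hτ hu with rfl | rfl | rfl
          · simpa using s1
          · simpa using s2
          · exact absurd rfl hne)
      have := mul_mem (mul_mem h1 h2) h3
      rw [AddMonoidAlgebra.single_mul_single, AddMonoidAlgebra.single_mul_single] at this
      rw [hsum]
      simpa using this
    have hdec : f = ∑ m ∈ f.coeff.support, f.coeff m • (AddMonoidAlgebra.single m 1 : Laurent) := by
      conv_lhs => rw [← AddMonoidAlgebra.sum_coeff_single f]
      rw [Finsupp.sum]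
      refine Finset.sum_congr rfl fun m _ => ?_
      simp
    rw [hdec]
    exact sum_mem fun m hm => Subalgebra.smul_mem _ (key m (hf m hm)) _

instance (r a : ℕ) [IsTerminalType r a] : IsLocallyNoetherian (economicResolution r a) := by
  rw [economicResolution,
    isLocallyNoetherian_iff_openCover (Scheme.IsLocallyDirected.openCover (diagram r a))]
  intro τ
  have : IsNoetherianRing (chartRing r a τ.1) := isNoetherianRing_of_fg (chartRing_fg r a τ)
  exact inferInstanceAs (IsLocallyNoetherian (Spec (CommRingCat.of (chartRing r a τ.1))))

/-! ### The morphism to `X` -/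

/-- The inclusion of the polynomials into the Laurent polynomials. -/
def toLaurent : MvPolynomial (Fin 3) ℂ →ₐ[ℂ] Laurent :=
  MvPolynomial.aeval fun i => AddMonoidAlgebra.single (Pi.single i 1) 1

lemma toLaurent_monomial (m : Fin 3 →₀ ℕ) (c : ℂ) :
    toLaurent (MvPolynomial.monomial m c) = AddMonoidAlgebra.single (fun i => (m i : ℤ)) c := by
  rw [toLaurent, MvPolynomial.aeval_monomial, Finsupp.prod_fintype _ _ (by simp)]
  simp only [Fin.prod_univ_three, AddMonoidAlgebra.single_pow, AddMonoidAlgebra.single_mul_single,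
    one_pow, mul_one, AddMonoidAlgebra.coe_algebraMap, Function.comp_apply, Algebra.algebraMap_self,
    RingHom.id_apply, zero_add]
  congr 1
  funext i
  fin_cases i <;> simp

lemma action_monomial (r a : ℕ) (m : Fin 3 →₀ ℕ) (c : ℂ) :
    action r a (MvPolynomial.monomial m c) = MvPolynomial.monomial m
      (Complex.exp (2 * Real.pi * Complex.I / r) ^ (∑ i, weight a i * m i) * c) := by
  rw [action, MvPolynomial.aeval_monomial, Finsupp.prod_fintype _ _ (by simp),
    MvPolynomial.monomial_eq, Finsupp.prod_fintype _ _ (by simp)]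
  simp only [mul_pow, Finset.prod_mul_distrib, ← map_pow, ← map_prod]
  rw [← mul_assoc, MvPolynomial.algebraMap_eq, ← map_mul]
  congr 2
  rw [mul_comm c]
  congr 1
  have h0 := Complex.exp_ne_zero (2 * Real.pi * Complex.I / r)
  simp only [Fin.sum_univ_three, Fin.prod_univ_three, zpow_add₀ h0, zpow_mul, zpow_natCast]

lemma coeff_action (r a : ℕ) (f : MvPolynomial (Fin 3) ℂ) (m : Fin 3 →₀ ℕ) :
    (action r a f).coeff m =
      Complex.exp (2 * Real.pi * Complex.I / r) ^ (∑ i, weight a i * m i) * f.coeff m := by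
  induction f using MvPolynomial.induction_on' with
  | monomial n c =>
    rw [action_monomial, MvPolynomial.coeff_monomial, MvPolynomial.coeff_monomial]
    split_ifs with h
    · rw [h]
    · simp
  | add p q hp hq => rw [map_add, MvPolynomial.coeff_add, MvPolynomial.coeff_add, hp, hq]; ring

lemma mem_invariants {r a : ℕ} [IsTerminalType r a] {f : MvPolynomial (Fin 3) ℂ} :
    f ∈ invariants r a ↔ ∀ m ∈ f.support, (r : ℤ) ∣ ∑ i, weight a i * m i := by
  have hr : r ≠ 0 := by
    have := IsTerminalType.lt (r := r) (a := a)
    omega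
  have hξ := Complex.isPrimitiveRoot_exp r hr
  change action r a f = f ↔ _
  rw [MvPolynomial.ext_iff]
  refine forall_congr' fun m => ?_
  rw [coeff_action, MvPolynomial.mem_support_iff, ← hξ.zpow_eq_one_iff_dvd]
  by_cases h : f.coeff m = 0
  · simp [h]
  · simp [h]

lemma nonneg_of_mem_fan {r a : ℕ} [IsTerminalType r a] (τ : Fan r a) {v : Fin 3 → ℚ}
    (hv : v ∈ τ.1) : 0 ≤ v := by
  obtain ⟨c, hc, hτ⟩ := τ.2
  obtain ⟨h1, h2, h3⟩ := (isCone_fan hc).nonneg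
  rcases hτ hv with rfl | rfl | rfl <;> assumption

lemma toLaurent_mem {r a : ℕ} [IsTerminalType r a] (τ : Fan r a) (f : invariants r a) :
    toLaurent f.1 ∈ chartRing r a τ.1 := by
  rw [f.1.as_sum, map_sum]
  refine sum_mem fun m hm => ?_
  rw [toLaurent_monomial]
  refine single_mem ⟨mem_invariants.1 f.2 m hm, fun v hv => ?_⟩ _
  exact Finset.sum_nonneg fun i _ => mul_nonneg (nonneg_of_mem_fan τ hv i) (by positivity)

/-- The inclusion of the invariant polynomials into a chart ring. -/
def toChart (r a : ℕ) [IsTerminalType r a] (τ : Fan r a) : invariants r a →ₐ[ℂ] chartRing r a τ.1 :=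
  (toLaurent.comp (invariants r a).val).codRestrict _ (toLaurent_mem τ)

/-- The resolution morphism `Y ⟶ X`, given on each chart by the inclusion of coordinate rings. -/
def resolution (r a : ℕ) [IsTerminalType r a] : economicResolution r a ⟶ quotient r a :=
  colimit.desc (diagram r a)
    { pt := quotient r a
      ι :=
        { app := fun τ => Spec.map (CommRingCat.ofHom (toChart r a τ).toRingHom)
          naturality := fun τ σ h => by
            change Spec.map _ ≫ Spec.map _ = Spec.map _ ≫ 𝟙 _
            rw [← Spec.map_comp, Category.comp_id]; rfl } }

instance (r a : ℕ) [IsTerminalType r a] : IsNoetherianRing (invariants r a) := by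
  have hr : r ≠ 0 := by
    have := IsTerminalType.lt (r := r) (a := a)
    omega
  have hX : ∀ i : Fin 3, (MvPolynomial.X i ^ r : MvPolynomial (Fin 3) ℂ) ∈ invariants r a := by
    intro i
    rw [mem_invariants]
    intro m hm
    rw [MvPolynomial.X_pow_eq_monomial, MvPolynomial.support_monomial, if_neg one_ne_zero,
      Finset.mem_singleton] at hm
    subst hm
    refine Finset.dvd_sum fun j _ => ?_
    by_cases h : i = j
    · subst h; simp
    · simp [h]
  have hint : Algebra.IsIntegral (invariants r a) (MvPolynomial (Fin 3) ℂ) := by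
    constructor
    intro f
    induction f using MvPolynomial.induction_on with
    | C c => exact isIntegral_algebraMap (x := algebraMap ℂ (invariants r a) c)
    | add p q hp hq => exact hp.add hq
    | mul_X p i hp =>
      refine hp.mul (IsIntegral.of_pow (Nat.pos_of_ne_zero hr) ?_)
      exact isIntegral_algebraMap (x := (⟨_, hX i⟩ : invariants r a))
  have hft : Algebra.FiniteType (invariants r a) (MvPolynomial (Fin 3) ℂ) :=
    Algebra.FiniteType.of_restrictScalars_finiteType ℂ _ _
  have hfin : Module.Finite (invariants r a) (MvPolynomial (Fin 3) ℂ) :=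
    Algebra.IsIntegral.finite
  have := fg_of_fg_of_fg ℂ (invariants r a) (MvPolynomial (Fin 3) ℂ)
    (Algebra.FiniteType.out) hfin.fg_top Subtype.val_injective
  have : Algebra.FiniteType ℂ (invariants r a) := ⟨this⟩
  exact Algebra.FiniteType.isNoetherianRing ℂ _

instance (r a : ℕ) [IsTerminalType r a] : IsLocallyNoetherian (quotient r a) :=
  inferInstanceAs (IsLocallyNoetherian (Spec (CommRingCat.of (invariants r a))))

instance (r a : ℕ) : IsIntegral (quotient r a) :=
  inferInstanceAs (IsIntegral (Spec (CommRingCat.of (invariants r a))))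

/-! ### Exceptional divisors and discrepancies -/

/-- A prime divisor of `Y`, given by its generic point `y`, is exceptional for `f : Y ⟶ X` if its
image has codimension at least two. -/
def IsExceptionalDivisor {X Y : Scheme.{0}} (f : Y ⟶ X) (y : Y) : Prop :=
  Order.coheight y = 1 ∧ 1 < Order.coheight (f y)

/-- The form `db₀ ∧ db₁ ∧ db₂`. -/
def wedge {K : Type} [Field K] [Algebra ℂ K] (b : Fin 3 → K) : ⋀[K]^3 Ω[K⁄ℂ] :=
  exteriorPower.ιMulti K 3 fun i => KaehlerDifferential.D ℂ K (b i)

/-- The complex numbers inside the function field of a scheme over `ℂ`. -/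
def scalars {Z : Scheme.{0}} [IsIntegral Z] (π : Z ⟶ Spec (CommRingCat.of ℂ)) :
    ℂ →+* Z.functionField :=
  (Z.presheaf.germ ⊤ (genericPoint Z) trivial).hom.comp
    (π.appTop.hom.comp (Scheme.ΓSpecIso (CommRingCat.of ℂ)).inv.hom)

/-- The rational three-form `db₀ ∧ db₁ ∧ db₂` is nonzero and has order `n` along the prime divisor
with generic point `z`: it is `u • (dt₀ ∧ dt₁ ∧ dt₂)`, where `u` has order `n` at `z` and
`t₀, t₁, t₂` are elements of the local ring at `z` such that `dt₀ ∧ dt₁ ∧ dt₂` generates the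
three-forms of that local ring. -/
def HasFormOrder {Z : Scheme.{0}} [IsIntegral Z] [IsLocallyNoetherian Z]
    (π : Z ⟶ Spec (CommRingCat.of ℂ)) (b : Fin 3 → Z.functionField) (z : Z) (n : ℤ) : Prop :=
  letI : Algebra ℂ Z.functionField := (scalars π).toAlgebra
  ∃ t : Fin 3 → Z.presheaf.stalk z,
    (∀ c : Fin 3 → Z.presheaf.stalk z, ∃ e : Z.presheaf.stalk z,
      wedge (fun i => algebraMap (Z.presheaf.stalk z) Z.functionField (c i)) =
        algebraMap (Z.presheaf.stalk z) Z.functionField e •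
          wedge fun i => algebraMap (Z.presheaf.stalk z) Z.functionField (t i)) ∧
    ∃ u : Z.functionField,
      wedge b = u • wedge (fun i => algebraMap (Z.presheaf.stalk z) Z.functionField (t i)) ∧
      wedge b ≠ 0 ∧ Scheme.ord u z = n

/-- The rational section `h (db₀ ∧ db₁ ∧ db₂)^{⊗ m}` of the `m`-th power of the canonical sheaf is
nonzero and has order `n` along the prime divisor with generic point `z`. -/
def HasPluriformOrder {Z : Scheme.{0}} [IsIntegral Z] [IsLocallyNoetherian Z]
    (π : Z ⟶ Spec (CommRingCat.of ℂ)) (m : ℕ) (h : Z.functionField) (b : Fin 3 → Z.functionField)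
    (z : Z) (n : ℤ) : Prop :=
  h ≠ 0 ∧ ∃ k : ℤ, HasFormOrder π b z k ∧ n = Scheme.ord h z + m * k

/-- The discrepancy `a(X, E)` of the prime divisor `E` of the threefold `Y` with generic point `y`
is `q`. For some `m > 0` there is a rational section `ω = h (db₀ ∧ db₁ ∧ db₂)^{⊗ m}` that
generates `𝒪_X(m K_X)` at the generic point of `f(E)`, i.e. has order zero along all prime divisors
of `X` through that point, and the pullback of `ω` to `Y` has order `m q` along `E`.
The functions `h` and `bᵢ` are taken in the local ring of `X` at the image of the generic point of
`Y`, which is the function field of `X` when `f` is dominant. For normal `X` and birational `f` the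
number `q` does not depend on the choice of `m` and `ω`. -/
def HasDiscrepancy {X Y : Scheme.{0}} [IsIntegral X] [IsLocallyNoetherian X] [IsIntegral Y]
    [IsLocallyNoetherian Y] (π : X ⟶ Spec (CommRingCat.of ℂ)) (f : Y ⟶ X) (y : Y) (q : ℚ) : Prop :=
  ∃ (m : ℕ) (h : X.presheaf.stalk (f (genericPoint Y)))
    (b : Fin 3 → X.presheaf.stalk (f (genericPoint Y))) (n : ℤ), 0 < m ∧
    (∀ x : X, Order.coheight x = 1 → x ⤳ f y →
      HasPluriformOrder π m (algebraMap _ X.functionField h)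
        (fun i => algebraMap _ X.functionField (b i)) x 0) ∧
    HasPluriformOrder (f ≫ π) m ((f.stalkMap (genericPoint Y)).hom h)
      (fun i => (f.stalkMap (genericPoint Y)).hom (b i)) y n ∧
    (n : ℚ) = m * q

/-- The pullback to `Y` of an invariant polynomial, as a rational function on `Y`. -/
def pullbackFunction (r a : ℕ) [IsTerminalType r a] (g : invariants r a) :
    (economicResolution r a).functionField :=
  (economicResolution r a).presheaf.germ ⊤ (genericPoint (economicResolution r a)) trivial
    ((resolution r a).appTop ((Scheme.ΓSpecIso (CommRingCat.of (invariants r a))).inv g))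

/-- The vector `(1/r)(i a mod r, -i a mod r, i)`. -/
def divisorWeight (r a i : ℕ) : Fin 3 → ℚ :=
  ![(((i * a : ℤ) % r : ℤ) : ℚ) / r, (((-(i * a) : ℤ) % r : ℤ) : ℚ) / r, (i : ℚ) / r]

end CyclicQuotient

end

/-!
A codimension-one point of `Y` lies on a toric chart, and it is either a point of the torus or the
generic point of the divisor of a ray of the fan. The rays of the subdivision, apart from the three
coordinate axes, are the lattice points `v` with `v₀ + v₁ = 1` and `0 < v₂ < 1`, which are the
vectors `divisorWeight r a i`.

On the affine chart of a single ray the lattice of invariant monomials has a basis along which `v`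
takes the values `1, 0, 0`. So the divisor is cut out by one monomial, and its order is the minimum
of `v` over the exponents. For the discrepancy, up to a nonzero constant
`(dx ∧ dy ∧ dz)^⊗r = (xyz)^(-r(r-1)) (d(x^r) ∧ d(y^r) ∧ d(z^r))^⊗r`, and the right-hand side is
defined on `X`. A logarithmic form `dx/x ∧ dy/y ∧ dz/z` has order `-1` along every toric divisor,
so the form has order `r (v₀ + v₁ + v₂ - 1)` along the divisor of `v`. This is `0` on the
coordinate axes, so the form generates the pluricanonical sheaf of `X`.
-/

noncomputable section
namespace CyclicQuotient

/-! ### The rays of the fan -/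

/-- The vector `(1/r)(α p + β q + i s)`. -/
def conePoint (r α β i : ℤ) (p q s : Fin 3 → ℚ) : Fin 3 → ℚ :=
  (1 / (r : ℚ)) • ((α : ℚ) • p + (β : ℚ) • q + (i : ℚ) • s)

/-- `(1/r)(α, β, i)` is an interior lattice point of height less than one on the triangle
`α + β = r` of the cone of type `(1/r)(a, -a, 1)`. -/
structure IsInteriorPoint (r a α β i : ℤ) : Prop where
  left_pos : 0 < α
  right_pos : 0 < β
  pos : 0 < i
  lt : i < r
  add_eq : α + β = r
  dvd : r ∣ i * a - α

/-- The vectors given by the interior lattice points `IsInteriorPoint` of the cone spanned by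
`p`, `q`, `s`; these turn out to be the exceptional rays. -/
def interiorRays (r a : ℤ) (p q s : Fin 3 → ℚ) : Set (Fin 3 → ℚ) :=
  {v | ∃ α β i, IsInteriorPoint r a α β i ∧ v = conePoint r α β i p q s}

lemma conePoint_swap (r α β i : ℤ) (p q s : Fin 3 → ℚ) :
    conePoint r α β i p q s = conePoint r β α i q p s := by
  rw [conePoint, conePoint, add_comm ((α : ℚ) • p)]

lemma IsInteriorPoint.swap {r a a' α β i : ℤ} (h : IsInteriorPoint r a α β i)
    (ha : r ∣ a + a') : IsInteriorPoint r a' β α i where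
  left_pos := h.right_pos
  right_pos := h.left_pos
  pos := h.pos
  lt := h.lt
  add_eq := by rw [add_comm, h.add_eq]
  dvd := by
    obtain ⟨⟨k, hk⟩, ⟨l, hl⟩⟩ := And.intro ha h.dvd
    exact ⟨i * k - l - 1, by linear_combination i * hk - hl - h.add_eq⟩

lemma interiorRays_swap {r a a' : ℤ} (ha : r ∣ a + a') (p q s : Fin 3 → ℚ) :
    interiorRays r a p q s = interiorRays r a' q p s := by
  ext v
  constructor
  · rintro ⟨α, β, i, h, rfl⟩
    exact ⟨β, α, i, h.swap ha, conePoint_swap ..⟩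
  · rintro ⟨α, β, i, h, rfl⟩
    exact ⟨β, α, i, h.swap (add_comm a a' ▸ ha), conePoint_swap ..⟩

section starSubdivision
variable {r a a' : ℤ}

lemma IsInteriorPoint.exists_subcone {α β i : ℤ} (h : IsInteriorPoint r a α β i) (hα : α < a)
    (ha' : a ∣ a' + r) : ∃ j, IsInteriorPoint a a' α (a - α) j ∧ i * a = α + j * r := by
  obtain ⟨⟨j, hj⟩, ⟨k, hk⟩⟩ := And.intro h.dvd ha'
  have hr : 0 < r := h.pos.trans h.lt
  refine ⟨j, ⟨h.left_pos, sub_pos.2 hα, ?_, ?_, by ring, ⟨j * k - i, ?_⟩⟩, ?_⟩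
  · have : 0 < r * j := by nlinarith [h.pos, h.left_pos]
    exact pos_of_mul_pos_right this hr.le
  · have : r * j < r * a := by nlinarith [h.lt, h.left_pos]
    exact lt_of_mul_lt_mul_left this hr.le
  · linear_combination j * hk + hj
  · linear_combination hj

lemma IsInteriorPoint.exists_supercone {α β j : ℤ} (h : IsInteriorPoint a a' α β j) (har : a < r)
    (ha' : a ∣ a' + r) : ∃ i, IsInteriorPoint r a α (r - α) i ∧ i * a = α + j * r := by
  obtain ⟨⟨l, hl⟩, ⟨k, hk⟩⟩ := And.intro h.dvd ha'
  have ha : 0 < a := h.pos.trans h.lt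
  have hi : a * (j * k - l) = α + j * r := by linear_combination hl - j * hk
  refine ⟨j * k - l, ⟨h.left_pos, ?_, ?_, ?_, by ring, ⟨j, by linear_combination hi⟩⟩,
    by linear_combination hi⟩
  · linarith [h.add_eq, h.right_pos]
  · have : 0 < a * (j * k - l) := by nlinarith [h.pos, h.left_pos]
    exact pos_of_mul_pos_right this ha.le
  · have : a * (j * k - l) < a * r := by nlinarith [h.lt, h.add_eq, h.right_pos]
    exact lt_of_mul_lt_mul_left this ha.le

lemma conePoint_subcone {α i j : ℤ} (ha : a ≠ 0) (hr : r ≠ 0) (hij : i * a = α + j * r)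
    (p q s : Fin 3 → ℚ) :
    conePoint a α (a - α) j (conePoint r a (r - a) 1 p q s) q s =
      conePoint r α (r - α) i p q s := by
  have ha' : (a : ℚ) ≠ 0 := mod_cast ha
  have hr' : (r : ℚ) ≠ 0 := mod_cast hr
  have hij' : (i : ℚ) * a = α + j * r := mod_cast hij
  funext l
  simp only [conePoint, Pi.smul_apply, Pi.add_apply, smul_eq_mul, Int.cast_sub, Int.cast_one]
  field_simp
  linear_combination -(s l) * hij'

lemma mem_interiorRays_subcone_iff (ha : 0 < a) (har : a < r) (ha' : a ∣ a' + r)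
    (p q s v : Fin 3 → ℚ) :
    v ∈ interiorRays a a' (conePoint r a (r - a) 1 p q s) q s ↔
      ∃ α β i, IsInteriorPoint r a α β i ∧ α < a ∧ v = conePoint r α β i p q s := by
  have hr : r ≠ 0 := (ha.trans har).ne'
  constructor
  · rintro ⟨α, β, j, h, rfl⟩
    obtain ⟨i, hi, hij⟩ := h.exists_supercone har ha'
    obtain rfl : β = a - α := by linarith [h.add_eq]
    exact ⟨α, _, i, hi, sub_pos.1 h.right_pos, conePoint_subcone ha.ne' hr hij p q s⟩
  · rintro ⟨α, β, i, h, hα, rfl⟩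
    obtain ⟨j, hj, hij⟩ := h.exists_subcone hα ha'
    obtain rfl : β = r - α := by linarith [h.add_eq]
    exact ⟨α, _, j, hj, (conePoint_subcone ha.ne' hr hij p q s).symm⟩

lemma IsInteriorPoint.eq_one (hcop : IsCoprime r a) {β i : ℤ} (h : IsInteriorPoint r a a β i) :
    i = 1 := by
  have hdvd : r ∣ i - 1 :=
    hcop.dvd_of_dvd_mul_right (by simpa only [sub_mul, one_mul] using h.dvd)
  have := Int.eq_zero_of_dvd_of_nonneg_of_lt (by linarith [h.pos]) (by linarith [h.lt]) hdvd
  omega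

lemma interiorRays_eq_union (ha : 0 < a) (har : a < r) (hcop : IsCoprime r a) {b' : ℤ}
    (ha' : a ∣ a' + r) (hb' : r - a ∣ r - b') (p q s : Fin 3 → ℚ) :
    interiorRays r a p q s =
      insert (conePoint r a (r - a) 1 p q s)
        (interiorRays a a' (conePoint r a (r - a) 1 p q s) q s ∪
          interiorRays (r - a) b' p (conePoint r a (r - a) 1 p q s) s) := by
  have hswap : interiorRays (r - a) b' p (conePoint r a (r - a) 1 p q s) s =
      interiorRays (r - a) (-b') (conePoint r (r - a) (r - (r - a)) 1 q p s) p s := by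
    rw [interiorRays_swap (a' := -b') (by simp), conePoint_swap, sub_sub_cancel]
  ext v
  rw [Set.mem_insert_iff, Set.mem_union, mem_interiorRays_subcone_iff ha har ha', hswap,
    mem_interiorRays_subcone_iff (by linarith) (by linarith) (by rwa [neg_add_eq_sub])]
  constructor
  · rintro ⟨α, β, i, h, rfl⟩
    rcases lt_trichotomy α a with hα | rfl | hα
    · exact Or.inr (Or.inl ⟨α, β, i, h, hα, rfl⟩)
    · obtain rfl := h.eq_one hcop
      rw [← h.add_eq, add_sub_cancel_left]
      exact Or.inl rfl
    · exact Or.inr (Or.inr ⟨β, α, i, h.swap (by simp), by linarith [h.add_eq], conePoint_swap ..⟩)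
  · rintro (rfl | ⟨α, β, i, h, -, rfl⟩ | ⟨β, α, i, h, -, rfl⟩)
    · exact ⟨a, r - a, 1, ⟨ha, sub_pos.2 har, one_pos, by linarith, by ring, by simp⟩, rfl⟩
    · exact ⟨α, β, i, h, rfl⟩
    · exact ⟨α, β, i, h.swap (by simp), conePoint_swap ..⟩

end starSubdivision

lemma coprime_left {r a : ℕ} (h0 : 0 < a) (hcop : Nat.Coprime a r) :
    Nat.Coprime ((-(r : ℤ)) % a).toNat a := by
  rw [← Nat.isCoprime_iff_coprime, Int.toNat_of_nonneg (Int.emod_nonneg _ (by omega)),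
    Int.emod_def, sub_eq_add_neg, ← mul_neg]
  exact (Nat.isCoprime_iff_coprime.2 hcop).symm.neg_left.add_mul_left_left _

lemma coprime_right {r a : ℕ} (h1 : a < r) (hcop : Nat.Coprime a r) :
    Nat.Coprime (r % (r - a)) (r - a) := by
  rw [Nat.Coprime, ← Nat.gcd_rec]
  exact (Nat.coprime_self_sub_left h1.le).2 hcop

/-- The rays of the cones of a list. -/
def raysOf (L : List ((Fin 3 → ℚ) × (Fin 3 → ℚ) × (Fin 3 → ℚ))) : Set (Fin 3 → ℚ) :=
  {v | ∃ c ∈ L, v ∈ ({c.1, c.2.1, c.2.2} : Set (Fin 3 → ℚ))}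

lemma raysOf_append (L L' : List ((Fin 3 → ℚ) × (Fin 3 → ℚ) × (Fin 3 → ℚ))) :
    raysOf (L ++ L') = raysOf L ∪ raysOf L' := by
  ext v
  simp only [raysOf, List.mem_append, or_and_right, exists_or]
  rfl

lemma raysOf_singleton (p q s : Fin 3 → ℚ) : raysOf [(p, q, s)] = {p, q, s} := by
  simp only [raysOf, List.mem_singleton, exists_eq_left]
  rfl

lemma interiorRays_one (a : ℤ) (p q s : Fin 3 → ℚ) : interiorRays 1 a p q s = ∅ :=
  Set.eq_empty_of_forall_notMem fun _ ⟨_, _, _, h, _⟩ =>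
    (Int.lt_iff_add_one_le.1 h.pos).not_gt h.lt

lemma raysOf_maxCones (r a : ℕ) (p q s : Fin 3 → ℚ) (hcop : Nat.Coprime a r) (hlt : a < r) :
    raysOf (maxCones r a p q s) = {p, q, s} ∪ interiorRays r a p q s := by
  induction r using Nat.strong_induction_on generalizing a p q s with
  | _ r ih =>
  rw [maxCones]
  split_ifs with h01
  · obtain ⟨h0, h1⟩ := h01
    have h0' : (0 : ℤ) < a := mod_cast h0
    have h1' : (a : ℤ) < r := mod_cast h1
    have hmod := Int.toNat_of_nonneg (Int.emod_nonneg (-(r : ℤ)) h0'.ne')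
    have hmod_lt := Int.emod_lt_of_pos (-(r : ℤ)) h0'
    have hw : (1 / (r : ℚ)) • ((a : ℚ) • p + ((r : ℚ) - a) • q + s) =
        conePoint r a (r - a) 1 p q s := by simp [conePoint]
    have hU := interiorRays_eq_union (a' := -r % a) (b' := (r % (r - a) : ℕ)) h0' h1'
      (Nat.isCoprime_iff_coprime.2 hcop).symm
      (by rw [Int.emod_def]; exact ⟨-(-(r : ℤ) / a), by ring⟩)
      (by rw [Int.natCast_mod, Nat.cast_sub h1.le]; exact Int.dvd_self_sub_emod) p q s
    simp only [hw, raysOf_append, raysOf_singleton]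
    rw [ih a h1 _ _ q s (coprime_left h0 hcop) (by omega),
      ih (r - a) (by omega) _ p _ s (coprime_right h1 hcop) (Nat.mod_lt _ (by omega)), hmod,
      Nat.cast_sub h1.le, hU]
    ext v
    simp only [Set.mem_union, Set.mem_insert_iff, Set.mem_singleton_iff]
    tauto
  · obtain rfl : a = 0 := by omega
    obtain rfl : r = 1 := by simpa only [Nat.coprime_zero_left] using hcop
    rw [raysOf_singleton, Nat.cast_one, interiorRays_one, Set.union_empty]

lemma IsInteriorPoint.left_eq_emod {r a α β i : ℤ} (h : IsInteriorPoint r a α β i) :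
    α = i * a % r :=
  (Int.emod_eq_of_lt h.left_pos.le (by linarith [h.add_eq, h.right_pos])).symm.trans
    (Int.modEq_iff_dvd.2 h.dvd)

lemma IsInteriorPoint.right_eq_emod {r a α β i : ℤ} (h : IsInteriorPoint r a α β i) :
    β = -(i * a) % r := by
  rw [(h.swap (a' := -a) (by simp)).left_eq_emod, mul_neg]

lemma isInteriorPoint_emod {r a i : ℤ} (hcop : IsCoprime r a) (hi : 0 < i) (hir : i < r) :
    IsInteriorPoint r a (i * a % r) (-(i * a) % r) i := by
  have hr : 0 < r := hi.trans hir
  have hne : i * a % r ≠ 0 := fun h =>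
    (Int.le_of_dvd hi (hcop.dvd_of_dvd_mul_right (Int.dvd_of_emod_eq_zero h))).not_gt hir
  have h : IsInteriorPoint r a (i * a % r) (r - i * a % r) i :=
    ⟨(Int.emod_nonneg _ hr.ne').lt_of_ne' hne, sub_pos.2 (Int.emod_lt_of_pos _ hr), hi, hir,
      add_sub_cancel .., Int.dvd_self_sub_emod⟩
  rwa [← h.right_eq_emod]

lemma isInteriorPoint_divisorWeight {r a : ℕ} [IsTerminalType r a] {i : ℕ}
    (hi : i ∈ Set.Ico 1 r) : IsInteriorPoint r a (i * a % r) (-(i * a) % r) i :=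
  isInteriorPoint_emod (Nat.isCoprime_iff_coprime.2 IsTerminalType.coprime).symm
    (mod_cast hi.1) (mod_cast hi.2)

lemma divisorWeight_eq_conePoint (r a i : ℕ) :
    divisorWeight r a i = conePoint r (i * a % r) (-(i * a) % r) i
      (Pi.single 0 1) (Pi.single 1 1) (Pi.single 2 1) := by
  funext l
  fin_cases l <;> simp [divisorWeight, conePoint, div_eq_inv_mul]

lemma interiorRays_eq_image (r a : ℕ) [IsTerminalType r a] :
    interiorRays r a (Pi.single 0 1) (Pi.single 1 1) (Pi.single 2 1) =
      divisorWeight r a '' Set.Ico 1 r := by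
  ext v
  constructor
  · rintro ⟨α, β, i, h, rfl⟩
    lift i to ℕ using h.pos.le
    refine ⟨i, ⟨mod_cast h.pos, mod_cast h.lt⟩, ?_⟩
    rw [divisorWeight_eq_conePoint, ← h.left_eq_emod, ← h.right_eq_emod]
  · rintro ⟨i, hi, rfl⟩
    exact ⟨_, _, i, isInteriorPoint_divisorWeight hi, divisorWeight_eq_conePoint r a i⟩

lemma raysOf_fanMax (r a : ℕ) [IsTerminalType r a] :
    raysOf (fanMax r a) =
      Set.range (fun k => Pi.single k 1) ∪ divisorWeight r a '' Set.Ico 1 r := by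
  rw [fanMax, raysOf_maxCones r a _ _ _ IsTerminalType.coprime IsTerminalType.lt,
    interiorRays_eq_image]
  congr 1
  ext v
  simp [Fin.exists_fin_succ, eq_comm]

lemma divisorWeight_pos {r a : ℕ} [IsTerminalType r a] {i : ℕ} (hi : i ∈ Set.Ico 1 r)
    (k : Fin 3) : 0 < divisorWeight r a i k := by
  have h := isInteriorPoint_divisorWeight (a := a) hi
  have hr : (0 : ℚ) < r := mod_cast h.pos.trans h.lt
  fin_cases k
  · exact div_pos (mod_cast h.left_pos) hr
  · exact div_pos (mod_cast h.right_pos) hr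
  · exact div_pos (mod_cast h.pos) hr

lemma sum_divisorWeight {r a : ℕ} [IsTerminalType r a] {i : ℕ} (hi : i ∈ Set.Ico 1 r) :
    ∑ k, divisorWeight r a i k = 1 + (i : ℚ) / r := by
  have h := isInteriorPoint_divisorWeight (a := a) hi
  have hr : (r : ℚ) ≠ 0 := mod_cast (h.pos.trans h.lt).ne'
  have hsum : (((i * a : ℤ) % r : ℤ) : ℚ) + ((-(i * a : ℤ) % r : ℤ) : ℚ) = r :=
    mod_cast h.add_eq
  simp only [Fin.sum_univ_three, divisorWeight, Matrix.cons_val]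
  rw [← add_div, hsum, div_self hr]

/-! ### Monomials and monomial primes of the chart rings -/

lemma one_lt_height_of_lt {R : Type*} [CommRing R] [IsDomain R] {Q P : Ideal R} [Q.IsPrime]
    [P.IsPrime] (hQ : Q ≠ ⊥) (h : Q < P) : 1 < P.height := by
  have hQ1 : 1 ≤ Q.height :=
    le_add_self.trans (Ideal.height_add_one_le_of_lt_of_isPrime (bot_lt_iff_ne_bot.2 hQ))
  have hP : (1 : ℕ∞) + 1 ≤ P.height :=
    (add_le_add_left hQ1 1).trans (Ideal.height_add_one_le_of_lt_of_isPrime h)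
  exact lt_of_lt_of_le (by decide) hP

section chartRing
variable {r a : ℕ} {σ : Set (Fin 3 → ℚ)}

/-- The character `χ^m` of the torus, as an element of a chart ring on which it is regular. -/
def chi (m : Fin 3 → ℤ) (hm : m ∈ dualMonoid r a σ) : chartRing r a σ :=
  ⟨AddMonoidAlgebra.single m 1, single_mem hm 1⟩

lemma chi_congr {m n : Fin 3 → ℤ} (h : m = n) (hm : m ∈ dualMonoid r a σ)
    (hn : n ∈ dualMonoid r a σ) : chi m hm = chi n hn := by subst h; rfl

lemma chi_mul {m n : Fin 3 → ℤ} (hm : m ∈ dualMonoid r a σ) (hn : n ∈ dualMonoid r a σ) :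
    chi m hm * chi n hn = chi (m + n) (add_mem hm hn) :=
  Subtype.ext ((AddMonoidAlgebra.single_mul_single ..).trans (by rw [one_mul]; rfl))

lemma chi_pow {m : Fin 3 → ℤ} (hm : m ∈ dualMonoid r a σ) (n : ℕ) :
    chi m hm ^ n = chi (n • m) (nsmul_mem hm n) :=
  Subtype.ext ((AddMonoidAlgebra.single_pow ..).trans (by rw [one_pow]; rfl))

lemma chi_zero : chi 0 (zero_mem _) = (1 : chartRing r a σ) := rfl

lemma support_chi {m : Fin 3 → ℤ} (hm : m ∈ dualMonoid r a σ) :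
    (chi m hm).1.coeff.support = {m} :=
  Finsupp.support_single (hb := one_ne_zero) ..

lemma chi_ne_zero {m : Fin 3 → ℤ} (hm : m ∈ dualMonoid r a σ) : chi m hm ≠ 0 :=
  Subtype.coe_ne_coe.1 (AddMonoidAlgebra.single_ne_zero.2 one_ne_zero)

lemma isUnit_chi {m : Fin 3 → ℤ} (hm : m ∈ dualMonoid r a σ) (hm' : -m ∈ dualMonoid r a σ) :
    IsUnit (chi m hm) :=
  .of_mul_eq_one (chi (-m) hm') ((chi_mul ..).trans (chi_congr (add_neg_cancel m) _ (zero_mem _)))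

lemma support_nonempty {f : chartRing r a σ} (hf : f ≠ 0) : f.1.coeff.support.Nonempty :=
  Finsupp.support_nonempty_iff.2 fun h => hf (Subtype.ext (AddMonoidAlgebra.coeff_eq_zero.1 h))

lemma eq_sum_chi (f : chartRing r a σ) :
    f = ∑ m ∈ f.1.coeff.support.attach, f.1.coeff m.1 • chi m.1 (f.2 m.1 m.2) := by
  apply Subtype.ext
  rw [AddSubmonoidClass.coe_finsetSum]
  conv_lhs => rw [← AddMonoidAlgebra.sum_coeff_single f.1, Finsupp.sum, ← Finset.sum_attach]
  exact Finset.sum_congr rfl fun m _ => by simp [chi]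

lemma mem_submodule_of_chi_mem (W : Submodule ℂ (chartRing r a σ))
    (h : ∀ m (hm : m ∈ dualMonoid r a σ), chi m hm ∈ W) (f : chartRing r a σ) : f ∈ W := by
  rw [eq_sum_chi f]
  exact sum_mem fun m _ => W.smul_mem _ (h _ _)

lemma mem_of_chi_mem {I : Ideal (chartRing r a σ)} {f : chartRing r a σ}
    (h : ∀ m (hm : m ∈ f.1.coeff.support), chi m (f.2 m hm) ∈ I) : f ∈ I := by
  rw [eq_sum_chi f]
  refine sum_mem fun m _ => ?_
  rw [Algebra.smul_def]
  exact I.mul_mem_left _ (h m.1 m.2)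

lemma exists_add_eq_of_mem_support_mul {f g : Laurent} {m : Fin 3 → ℤ}
    (hm : m ∈ (f * g).coeff.support) :
    ∃ x ∈ f.coeff.support, ∃ y ∈ g.coeff.support, x + y = m := by
  classical
  exact Finset.mem_add.1 (AddMonoidAlgebra.support_coeff_mul_subset f g hm)

lemma chi_dvd_iff {m₀ : Fin 3 → ℤ} (hm₀ : m₀ ∈ dualMonoid r a σ) {f : chartRing r a σ} :
    chi m₀ hm₀ ∣ f ↔ ∀ m ∈ f.1.coeff.support, m - m₀ ∈ dualMonoid r a σ := by
  constructor
  · rintro ⟨g, rfl⟩ m hm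
    obtain ⟨x, hx, y, hy, rfl⟩ := exists_add_eq_of_mem_support_mul hm
    rw [support_chi, Finset.mem_singleton] at hx
    rw [hx, add_sub_cancel_left]
    exact g.2 y hy
  · intro h
    rw [← Ideal.mem_span_singleton]
    refine mem_of_chi_mem fun m hm => Ideal.mem_span_singleton.2 ⟨chi (m - m₀) (h m hm), ?_⟩
    rw [chi_mul]
    exact chi_congr (add_sub_cancel m₀ m).symm _ _

/-- The ideal of the elements of positive order along the ray `v`. -/
def divisorIdeal (r a : ℕ) {σ : Set (Fin 3 → ℚ)} {v : Fin 3 → ℚ} (hv : v ∈ σ) :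
    Ideal (chartRing r a σ) where
  carrier := {f | ∀ m ∈ f.1.coeff.support, 0 < pair v m}
  zero_mem' m hm := by simp at hm
  add_mem' {f g} hf hg m hm := by
    classical
    exact (Finset.mem_union.1 (Finsupp.support_add hm)).elim (hf m) (hg m)
  smul_mem' f g hg m hm := by
    obtain ⟨x, hx, y, hy, rfl⟩ := exists_add_eq_of_mem_support_mul hm
    rw [pair_add]
    exact add_pos_of_nonneg_of_pos ((f.2 x hx).2 v hv) (hg y hy)

lemma chi_mem_divisorIdeal {v : Fin 3 → ℚ} (hv : v ∈ σ) {m : Fin 3 → ℤ}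
    (hm : m ∈ dualMonoid r a σ) : chi m hm ∈ divisorIdeal r a hv ↔ 0 < pair v m := by
  change (∀ n ∈ (chi m hm).1.coeff.support, 0 < pair v n) ↔ _
  simp only [support_chi, Finset.mem_singleton, forall_eq]

/-- The part of `f` of order zero along the ray `v`. -/
def zeroPart (v : Fin 3 → ℚ) (f : chartRing r a σ) : chartRing r a σ :=
  ⟨.ofCoeff (f.1.coeff.filter fun m => pair v m = 0), fun m hm => by
    rw [AddMonoidAlgebra.coeff_ofCoeff, Finsupp.support_filter] at hm
    exact f.2 m (Finset.mem_filter.1 hm).1⟩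

lemma mem_support_zeroPart {v : Fin 3 → ℚ} {f : chartRing r a σ} {m : Fin 3 → ℤ} :
    m ∈ (zeroPart v f).1.coeff.support ↔ m ∈ f.1.coeff.support ∧ pair v m = 0 := by
  rw [zeroPart, AddMonoidAlgebra.coeff_ofCoeff, Finsupp.support_filter, Finset.mem_filter]

lemma sub_zeroPart_mem {v : Fin 3 → ℚ} (hv : v ∈ σ) (f : chartRing r a σ) :
    f - zeroPart v f ∈ divisorIdeal r a hv := by
  intro m hm
  have hc : (f - zeroPart v f).1.coeff m =
      f.1.coeff m - (f.1.coeff.filter fun m => pair v m = 0) m := rfl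
  rw [Finsupp.mem_support_iff, hc, Finsupp.filter_apply] at hm
  split_ifs at hm with h0
  · exact absurd (sub_self _) hm
  · rw [sub_zero, ← Finsupp.mem_support_iff] at hm
    exact ((f.2 m hm).2 v hv).lt_of_ne' h0

lemma mem_divisorIdeal_iff_zeroPart {v : Fin 3 → ℚ} (hv : v ∈ σ) {f : chartRing r a σ} :
    f ∈ divisorIdeal r a hv ↔ zeroPart v f = 0 := by
  refine ⟨fun h => ?_, fun h => ?_⟩
  · by_contra h0
    obtain ⟨m, hm⟩ := support_nonempty h0
    rw [mem_support_zeroPart] at hm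
    exact (h m hm.1).ne' hm.2
  · simpa only [h, sub_zero] using sub_zeroPart_mem hv f

lemma zeroPart_mul_zeroPart_eq_zero {v : Fin 3 → ℚ} {hv : v ∈ σ} {f g : chartRing r a σ}
    (h : zeroPart v f * zeroPart v g ∈ divisorIdeal r a hv) : zeroPart v f * zeroPart v g = 0 := by
  by_contra h0
  obtain ⟨m, hm⟩ := support_nonempty h0
  have hpos := h m hm
  obtain ⟨x, hx, y, hy, rfl⟩ := exists_add_eq_of_mem_support_mul hm
  rw [mem_support_zeroPart] at hx hy
  rw [pair_add, hx.2, hy.2, add_zero] at hpos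
  exact hpos.false

instance divisorIdeal_isPrime {v : Fin 3 → ℚ} (hv : v ∈ σ) : (divisorIdeal r a hv).IsPrime := by
  constructor
  · rw [Ne, Ideal.eq_top_iff_one, ← chi_zero, chi_mem_divisorIdeal]
    simp [pair]
  · intro f g hfg
    have hmem : zeroPart v f * zeroPart v g ∈ divisorIdeal r a hv := by
      have : zeroPart v f * zeroPart v g =
          f * g - (f - zeroPart v f) * g - zeroPart v f * (g - zeroPart v g) := by ring
      rw [this]
      exact sub_mem (sub_mem hfg (Ideal.mul_mem_right _ _ (sub_zeroPart_mem hv f)))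
        (Ideal.mul_mem_left _ _ (sub_zeroPart_mem hv g))
    simp only [mem_divisorIdeal_iff_zeroPart]
    exact mul_eq_zero.1 (zeroPart_mul_zeroPart_eq_zero hmem)

lemma chi_mem_of_forall_pos (hσ : σ.Finite) {m₀ m : Fin 3 → ℤ} (hm₀ : m₀ ∈ dualMonoid r a σ)
    (hm : m ∈ dualMonoid r a σ) (hpos : ∀ v ∈ σ, 0 < pair v m) {P : Ideal (chartRing r a σ)}
    [hP : P.IsPrime] (hmem : chi m₀ hm₀ ∈ P) : chi m hm ∈ P := by
  obtain ⟨N, hN⟩ : ∃ N : ℕ, ∀ v ∈ σ, pair v m₀ ≤ N * pair v m :=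
    ((Filter.eventually_all_finite hσ).2 fun v hv =>
      (tendsto_natCast_atTop_atTop.atTop_mul_const (hpos v hv)).eventually_ge_atTop _).exists
  have hsub : N • m - m₀ ∈ dualMonoid r a σ := by
    refine ⟨sub_mem (nsmul_mem hm.1 N) hm₀.1, fun v hv => ?_⟩
    rw [sub_eq_add_neg, pair_add, pair_neg, pair_nsmul]
    linarith [hN v hv]
  refine hP.mem_of_pow_mem N (P.mem_of_dvd ⟨chi (N • m - m₀) hsub, ?_⟩ hmem)
  rw [chi_pow, chi_mul]
  exact chi_congr (add_sub_cancel ..).symm _ _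

lemma exists_divisorIdeal_le (hσ : σ.Finite) {m₀ : Fin 3 → ℤ} (hm₀ : m₀ ∈ dualMonoid r a σ)
    {P : Ideal (chartRing r a σ)} [hP : P.IsPrime] (hmem : chi m₀ hm₀ ∈ P) :
    ∃ v, ∃ hv : v ∈ σ, divisorIdeal r a hv ≤ P := by
  have hinf : (hσ.toFinset.attach.inf fun v => divisorIdeal r a (hσ.mem_toFinset.1 v.2)) ≤ P := by
    intro f hf
    rw [Submodule.mem_finsetInf] at hf
    exact mem_of_chi_mem fun m hm => chi_mem_of_forall_pos hσ hm₀ _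
      (fun v hv => hf ⟨v, hσ.mem_toFinset.2 hv⟩ (Finset.mem_attach _ _) m hm) hmem
  obtain ⟨v, -, hv⟩ := hP.inf_le'.1 hinf
  exact ⟨v.1, hσ.mem_toFinset.1 v.2, hv⟩

/-- The inclusion of a chart ring into the ring of a face. -/
abbrev faceHom {τ : Set (Fin 3 → ℚ)} (h : τ ⊆ σ) : chartRing r a σ →+* chartRing r a τ :=
  (Subalgebra.inclusion (chartRing_anti (r := r) (a := a) h)).toRingHom

lemma exists_face_of_height_eq_one (hσ : σ.Finite) {m₀ : Fin 3 → ℤ} (hm₀ : m₀ ∈ latticeM r a)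
    (hpos : ∀ v ∈ σ, 1 ≤ pair v m₀) (P : PrimeSpectrum (chartRing r a σ))
    (hP : P.asIdeal.height = 1) :
    (∃ Q : PrimeSpectrum (chartRing r a ∅),
        PrimeSpectrum.comap (faceHom (Set.empty_subset σ)) Q = P) ∨
      ∃ v, ∃ hv : v ∈ σ, PrimeSpectrum.comap (faceHom (Set.singleton_subset_iff.2 hv))
        ⟨divisorIdeal r a (Set.mem_singleton v), inferInstance⟩ = P := by
  have hm : m₀ ∈ dualMonoid r a σ := ⟨hm₀, fun v hv => zero_le_one.trans (hpos v hv)⟩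
  by_cases hmem : chi m₀ hm ∈ P.asIdeal
  · right
    obtain ⟨v, hv, hle⟩ := exists_divisorIdeal_le hσ hm hmem
    refine ⟨v, hv, PrimeSpectrum.ext (?_ : divisorIdeal r a hv = P.asIdeal)⟩
    have hne : divisorIdeal r a hv ≠ ⊥ := fun h0 => chi_ne_zero hm <| by
      rw [← Ideal.mem_bot, ← h0, chi_mem_divisorIdeal]
      exact zero_lt_one.trans_le (hpos v hv)
    exact hle.eq_of_not_lt fun hlt => (one_lt_height_of_lt hne hlt).ne' hP
  · left
    let _ := (faceHom (r := r) (a := a) (Set.empty_subset σ)).toAlgebra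
    have : IsLocalization.Away (chi m₀ hm) (chartRing r a ∅) :=
      isLocalization_face (Set.empty_subset σ) hm₀ (by simp) (fun v hv _ => hpos v hv) hm hσ
    have hP' : P ∈ (PrimeSpectrum.basicOpen (chi m₀ hm) : Set _) := hmem
    rwa [← PrimeSpectrum.localization_away_comap_range (chartRing r a ∅)] at hP'

end chartRing

/-! ### Dual bases -/

/-- `μ` is a basis of the lattice `M`, dual to the vectors `ρ`. -/
structure IsDualBasis (r a : ℕ) (ρ : Fin 3 → Fin 3 → ℚ) (μ : Fin 3 → Fin 3 → ℤ) : Prop where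
  mem : ∀ j, μ j ∈ latticeM r a
  pair_eq : ∀ i j, pair (ρ i) (μ j) = if i = j then 1 else 0
  span : ∀ m ∈ latticeM r a, ∃ k : Fin 3 → ℤ, (∀ l, pair (ρ l) m = k l) ∧ m = ∑ l, k l • μ l

lemma IsCone.exists_isDualBasis {r a : ℕ} {p q s : Fin 3 → ℚ} (h : IsCone r a 1 0 p q s) :
    ∃ μ, IsDualBasis r a ![p, q, s] μ := by
  obtain ⟨mp, hmp, p1, p2, p3⟩ := h.surj 1 0 0 (by simp)
  obtain ⟨mq, hmq, q1, q2, q3⟩ := h.surj 0 1 0 (by simp)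
  obtain ⟨ms, hms, s1, s2, s3⟩ := h.surj 0 0 1 (by simp)
  refine ⟨![mp, mq, ms], ?_, ?_, fun m hm => ?_⟩
  · intro j; fin_cases j <;> assumption
  · intro i j; fin_cases i <;> fin_cases j <;> simp [*]
  · obtain ⟨α, β, γ, hα, hβ, hγ, -⟩ := h.int m hm
    refine ⟨![α, β, γ], by intro l; fin_cases l <;> simp [*], ?_⟩
    have hM : m - (α • mp + β • mq + γ • ms) ∈ latticeM r a :=
      sub_mem hm (add_mem (add_mem (zsmul_mem hmp _) (zsmul_mem hmq _)) (zsmul_mem hms _))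
    rw [Fin.sum_univ_three]
    change m = α • mp + β • mq + γ • ms
    refine sub_eq_zero.1 (h.inj _ hM ?_ ?_ ?_) <;>
      simp only [sub_eq_add_neg, pair_add, pair_neg, pair_zsmul, hα, hβ, hγ, p1, p2, p3, q1, q2,
        q3, s1, s2, s3] <;> push_cast <;> ring

lemma exists_isDualBasis_fan {r a : ℕ} [IsTerminalType r a] (τ : Fan r a) :
    ∃ ρ μ, IsDualBasis r a ρ μ ∧ τ.1 ⊆ Set.range ρ := by
  obtain ⟨c, hc, hτ⟩ := τ.2
  obtain ⟨μ, hμ⟩ := (isCone_fan hc).exists_isDualBasis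
  refine ⟨_, μ, hμ, hτ.trans ?_⟩
  rintro v (rfl | rfl | rfl)
  exacts [⟨0, rfl⟩, ⟨1, rfl⟩, ⟨2, rfl⟩]

namespace IsDualBasis
variable {r a : ℕ} {ρ : Fin 3 → Fin 3 → ℚ} {μ : Fin 3 → Fin 3 → ℤ} (h : IsDualBasis r a ρ μ)
include h

lemma mem_dualMonoid {τ : Set (Fin 3 → ℚ)} (hτ : τ ⊆ Set.range ρ) (j : Fin 3) :
    μ j ∈ dualMonoid r a τ := by
  refine ⟨h.mem j, fun v hv => ?_⟩
  obtain ⟨i, rfl⟩ := hτ hv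
  rw [h.pair_eq]
  split_ifs <;> norm_num

lemma mem_dualMonoid_ray (l : Fin 3) : μ l ∈ dualMonoid r a {ρ l} :=
  h.mem_dualMonoid (Set.singleton_subset_iff.2 ⟨l, rfl⟩) l

lemma chi_pow_dvd_iff (l : Fin 3) (n : ℕ) {f : chartRing r a {ρ l}} :
    chi (μ l) (h.mem_dualMonoid_ray l) ^ n ∣ f ↔ ∀ m ∈ f.1.coeff.support, n ≤ pair (ρ l) m := by
  rw [chi_pow, chi_dvd_iff]
  refine forall₂_congr fun m hm => ?_
  have hpair : pair (ρ l) (m - n • μ l) = pair (ρ l) m - n := by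
    rw [sub_eq_add_neg, pair_add, pair_neg, pair_nsmul, h.pair_eq, if_pos rfl, mul_one,
      ← sub_eq_add_neg]
  rw [← sub_nonneg, ← hpair]
  exact ⟨fun hsub => hsub.2 _ rfl, fun hle => ⟨sub_mem (f.2 m hm).1 (nsmul_mem (h.mem l) n),
    by rintro v rfl; exact hle⟩⟩

lemma divisorIdeal_eq_span (l : Fin 3) :
    divisorIdeal r a (Set.mem_singleton (ρ l)) =
      Ideal.span {chi (μ l) (h.mem_dualMonoid_ray l)} := by
  ext f
  rw [Ideal.mem_span_singleton, ← pow_one (chi _ _), h.chi_pow_dvd_iff]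
  refine forall₂_congr fun m hm => ?_
  obtain ⟨k, hk, -⟩ := h.span m (f.2 m hm).1
  rw [hk l, Nat.cast_one]
  exact_mod_cast Int.lt_iff_add_one_le (a := 0)

lemma exists_eq_pow_mul (l : Fin 3) {f : chartRing r a {ρ l}} (hf : f ≠ 0) :
    ∃ (n : ℕ) (g : chartRing r a {ρ l}), g ∉ divisorIdeal r a (Set.mem_singleton (ρ l)) ∧
      f = chi (μ l) (h.mem_dualMonoid_ray l) ^ n * g ∧
      IsLeast (pair (ρ l) '' f.1.coeff.support) n := by
  obtain ⟨m₀, hm₀, hmin⟩ := f.1.coeff.support.exists_min_image (pair (ρ l)) (support_nonempty hf)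
  obtain ⟨k, hk, -⟩ := h.span m₀ (f.2 m₀ hm₀).1
  have hk0 : 0 ≤ k l := by
    have := (f.2 m₀ hm₀).2 _ (Set.mem_singleton _)
    rw [hk] at this
    exact_mod_cast this
  obtain ⟨n, hn⟩ := Int.eq_ofNat_of_zero_le hk0
  have hm₀n : pair (ρ l) m₀ = n := by rw [hk, hn, Int.cast_natCast]
  rw [hm₀n] at hmin
  obtain ⟨g, hg⟩ := (h.chi_pow_dvd_iff l n).2 hmin
  refine ⟨n, g, fun hmem => ?_, hg, ⟨m₀, hm₀, hm₀n⟩, Set.forall_mem_image.2 hmin⟩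
  rw [h.divisorIdeal_eq_span, Ideal.mem_span_singleton] at hmem
  have hdvd : chi (μ l) (h.mem_dualMonoid_ray l) ^ (n + 1) ∣ f := by
    rw [hg, pow_succ]
    exact mul_dvd_mul_left _ hmem
  have := (h.chi_pow_dvd_iff l (n + 1)).1 hdvd m₀ hm₀
  rw [hm₀n, Nat.cast_le] at this
  omega

end IsDualBasis

/-! ### The invariant ring as the chart ring of the positive octant -/

lemma aeval_single_eq_mapDomain {R σ M : Type*} [CommSemiring R] [Fintype σ] [AddCommMonoid M]
    (u : σ → M) (f : MvPolynomial σ R) :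
    MvPolynomial.aeval (fun i => AddMonoidAlgebra.single (u i) (1 : R)) f =
      AddMonoidAlgebra.mapDomain (fun n : σ →₀ ℕ => ∑ i, n i • u i) f := by
  induction f using MvPolynomial.induction_on' with
  | monomial n c =>
    have hprod : ∏ i, AddMonoidAlgebra.single (u i) (1 : R) ^ n i =
        AddMonoidAlgebra.single (∑ i, n i • u i) 1 := by
      simp only [AddMonoidAlgebra.single_pow, one_pow, AddMonoidAlgebra.prod_single,
        Finset.prod_const_one]
    rw [MvPolynomial.aeval_monomial, Finsupp.prod_fintype _ _ fun _ => pow_zero _, hprod,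
      ← Algebra.smul_def, AddMonoidAlgebra.smul_single, smul_eq_mul, mul_one]
    exact (AddMonoidAlgebra.mapDomain_single (f := fun n : σ →₀ ℕ => ∑ i, n i • u i)).symm
  | add p q hp hq => rw [map_add, hp, hq]; exact (AddMonoidAlgebra.mapDomain_add (R := R) ..).symm

lemma natCast_comp_injective {σ : Type*} :
    Function.Injective fun (n : σ →₀ ℕ) i => (n i : ℤ) :=
  fun _ _ h => Finsupp.ext fun i => Nat.cast_injective (congrFun h i)

lemma toLaurent_eq_mapDomain (f : MvPolynomial (Fin 3) ℂ) :
    toLaurent f = AddMonoidAlgebra.mapDomain (fun (n : Fin 3 →₀ ℕ) i => (n i : ℤ)) f := by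
  rw [toLaurent, aeval_single_eq_mapDomain]
  congr
  ext n i
  simp [Finset.sum_apply, Pi.single_apply]

lemma toLaurent_injective : Function.Injective toLaurent := fun f g h =>
  AddMonoidAlgebra.mapDomain_injective natCast_comp_injective <| by
    rwa [toLaurent_eq_mapDomain, toLaurent_eq_mapDomain] at h

lemma support_toLaurent (f : MvPolynomial (Fin 3) ℂ) :
    ((toLaurent f).coeff.support : Set (Fin 3 → ℤ)) =
      (fun (n : Fin 3 →₀ ℕ) i => (n i : ℤ)) '' (f.support : Set (Fin 3 →₀ ℕ)) := by
  classical
  rw [toLaurent_eq_mapDomain, AddMonoidAlgebra.coeff_mapDomain,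
    Finsupp.mapDomain_support_of_injective natCast_comp_injective, Finset.coe_image]
  rfl

/-- The rays of the positive octant. -/
def octant : Set (Fin 3 → ℚ) := Set.range fun k : Fin 3 => (Pi.single k 1 : Fin 3 → ℚ)

lemma pair_single (k : Fin 3) (m : Fin 3 → ℤ) : pair (Pi.single k 1) m = m k := by
  simp only [pair, Pi.single_apply, ite_mul, one_mul, zero_mul, Finset.sum_ite_eq',
    Finset.mem_univ, if_true]

lemma toLaurent_mem_octant_iff {r a : ℕ} [IsTerminalType r a] {f : MvPolynomial (Fin 3) ℂ} :
    toLaurent f ∈ chartRing r a octant ↔ f ∈ invariants r a := by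
  rw [mem_invariants]
  change (∀ m ∈ ((toLaurent f).coeff.support : Set (Fin 3 → ℤ)), _) ↔ _
  rw [support_toLaurent, Set.forall_mem_image]
  refine forall₂_congr fun n _ => ⟨fun h => h.1, fun h => ⟨h, ?_⟩⟩
  rintro _ ⟨k, rfl⟩
  rw [pair_single]
  positivity

/-- The inclusion of the invariant polynomials into the chart ring of the octant. -/
def toOctant (r a : ℕ) [IsTerminalType r a] : invariants r a →ₐ[ℂ] chartRing r a octant :=
  (toLaurent.comp (invariants r a).val).codRestrict _ fun f => toLaurent_mem_octant_iff.2 f.2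

lemma toOctant_surjective (r a : ℕ) [IsTerminalType r a] :
    Function.Surjective (toOctant r a) := by
  intro f
  have hrange : (f.1.coeff.support : Set (Fin 3 → ℤ)) ⊆
      Set.range fun (n : Fin 3 →₀ ℕ) i => (n i : ℤ) := by
    intro m hm
    have hnonneg (k : Fin 3) : 0 ≤ m k := by
      have := (f.2 m hm).2 _ ⟨k, rfl⟩
      rw [pair_single] at this
      exact_mod_cast this
    exact ⟨Finsupp.equivFunOnFinite.symm fun k => (m k).toNat,
      funext fun k => Int.toNat_of_nonneg (hnonneg k)⟩
  let g : MvPolynomial (Fin 3) ℂ := AddMonoidAlgebra.comapDomain _ natCast_comp_injective f.1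
  have hg : toLaurent g = f.1 :=
    (toLaurent_eq_mapDomain g).trans (AddMonoidAlgebra.mapDomain_comapDomain hrange _)
  exact ⟨⟨g, toLaurent_mem_octant_iff.1 (hg ▸ f.2)⟩, Subtype.ext hg⟩

/-- The invariant ring is the chart ring of the octant. -/
def octantEquiv (r a : ℕ) [IsTerminalType r a] : invariants r a ≃ₐ[ℂ] chartRing r a octant :=
  AlgEquiv.ofBijective (toOctant r a)
    ⟨fun _ _ h => Subtype.ext (toLaurent_injective (congrArg Subtype.val h)),
      toOctant_surjective r a⟩

lemma toChart_eq {r a : ℕ} [IsTerminalType r a] (τ : Fan r a) (hτ : τ.1 ⊆ octant) :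
    (toChart r a τ).toRingHom = (faceHom hτ).comp (octantEquiv r a).toRingEquiv.toRingHom := rfl

/-! ### The order along a principal prime -/

lemma height_eq_one_of_eq_span {A : Type*} [CommRing A] [IsDomain A] [IsNoetherianRing A]
    {P : Ideal A} [P.IsPrime] {t : A} (hP : P = Ideal.span {t}) (ht : t ≠ 0) : P.height = 1 := by
  apply le_antisymm
  · have : (Ideal.span {t}).IsPrincipal := ⟨t, rfl⟩
    refine Ideal.height_le_one_of_isPrincipal_of_mem_minimalPrimes (Ideal.span {t}) P ?_
    rw [← hP, Ideal.minimalPrimes_eq_subsingleton_self]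
    exact Set.mem_singleton _
  · have hbot : (⊥ : Ideal A) < P := by
      rw [bot_lt_iff_ne_bot, hP, Ne, Ideal.span_singleton_eq_bot]
      exact ht
    exact le_add_self.trans (Ideal.height_add_one_le_of_lt_of_isPrime hbot)

lemma ord_eq_one_of_maximalIdeal_eq_span {S : Type*} [CommRing S] [IsLocalRing S] {t : S}
    (ht : IsLocalRing.maximalIdeal S = Ideal.span {t}) : Ring.ord S t = 1 := by
  rw [Ring.ord, Module.length_eq_one_iff, ← ht,
    isSimpleModule_iff_isSimpleModule_of_algebraMap_surjective
      (S := S ⧸ IsLocalRing.maximalIdeal S) Ideal.Quotient.mk_surjective]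
  let := Ideal.Quotient.field (IsLocalRing.maximalIdeal S)
  exact instIsSimpleModule _

lemma ord_pow_mul {A S : Type*} [CommRing A] [CommRing S] [IsDomain S] [Algebra A S] {P : Ideal A}
    [P.IsPrime] [IsLocalization.AtPrime S P] {t : A} (hP : P = Ideal.span {t})
    (ht : algebraMap A S t ≠ 0) (n : ℕ) {g : A} (hg : g ∉ P) :
    Ring.ord S (algebraMap A S (t ^ n * g)) = n := by
  have hu : IsUnit (algebraMap A S g) := IsLocalization.map_units S (⟨g, hg⟩ : P.primeCompl)
  have : IsLocalRing S := IsLocalization.AtPrime.isLocalRing S P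
  have hmax : IsLocalRing.maximalIdeal S = Ideal.span {algebraMap A S t} := by
    rw [← IsLocalization.AtPrime.map_eq_maximalIdeal P S, hP, Ideal.map_span, Set.image_singleton]
  rw [map_mul, map_pow, Ring.ord_mul_of_isUnit_right hu,
    Ring.ord_pow (mem_nonZeroDivisors_of_ne_zero ht), ord_eq_one_of_maximalIdeal_eq_span hmax,
    nsmul_one]

/-! ### Three-forms -/

section Wedge
variable {K : Type} [Field K] [Algebra ℂ K]

lemma wedge_eq_det_smul (e : Module.Basis (Fin 3) K Ω[K⁄ℂ]) {t : Fin 3 → K}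
    (ht : ∀ l, e l = KaehlerDifferential.D ℂ K (t l)) (c : Fin 3 → K) :
    wedge c = e.det (fun i => KaehlerDifferential.D ℂ K (c i)) • wedge t := by
  have : exteriorPower.ιMulti K 3 (M := Ω[K⁄ℂ]) =
      (LinearMap.toSpanSingleton K _ (wedge t)).compAlternatingMap e.det := by
    refine Module.Basis.ext_alternating e fun i h => ?_
    let σ : Equiv.Perm (Fin 3) := Equiv.ofBijective i (Finite.injective_iff_bijective.1 h)
    change exteriorPower.ιMulti K 3 (e ∘ σ) =
      ((LinearMap.toSpanSingleton K _ (wedge t)).compAlternatingMap e.det) (e ∘ σ)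
    rw [AlternatingMap.map_perm, AlternatingMap.map_perm]
    congr 1
    simp only [LinearMap.compAlternatingMap_apply, e.det_self, LinearMap.toSpanSingleton_apply,
      one_smul, wedge]
    congr 1
    exact funext ht
  exact congrArg (fun f => f fun i => KaehlerDifferential.D ℂ K (c i)) this

lemma wedge_ne_zero (e : Module.Basis (Fin 3) K Ω[K⁄ℂ]) {t : Fin 3 → K}
    (ht : ∀ l, e l = KaehlerDifferential.D ℂ K (t l)) : wedge t ≠ 0 := by
  intro h
  have hdet : e.det (fun i => KaehlerDifferential.D ℂ K (t i)) = 0 := by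
    rw [← exteriorPower.alternatingMapLinearEquiv_apply_ιMulti]
    exact (congrArg _ h).trans (map_zero _)
  rw [← funext ht, e.det_self] at hdet
  exact one_ne_zero hdet

end Wedge

lemma exists_basis_differentials {k K ι : Type*} [Field k] [Field K] [Algebra k K] {t : ι → K}
    (ht : AlgebraicIndependent k t) (htop : IntermediateField.adjoin k (Set.range t) = ⊤) :
    ∃ e : Module.Basis ι K Ω[K⁄k], ∀ l, e l = KaehlerDifferential.D k K (t l) := by
  let _ : Algebra (MvPolynomial ι k) K := (MvPolynomial.aeval (R := k) t).toAlgebra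
  have hmap (x) : algebraMap (MvPolynomial ι k) K x = MvPolynomial.aeval t x := rfl
  have : IsScalarTower k (MvPolynomial ι k) K :=
    IsScalarTower.of_algebraMap_eq fun c => by
      rw [hmap, MvPolynomial.algebraMap_eq, MvPolynomial.aeval_C]
  have : FaithfulSMul (MvPolynomial ι k) K := (faithfulSMul_iff_algebraMap_injective _ _).2 ht
  have : IsFractionRing (MvPolynomial ι k) K := IsFractionRing.of_field _ _ fun z =>
    (IntermediateField.mem_adjoin_range_iff k t z).1 (htop ▸ IntermediateField.mem_top)
  refine ⟨(KaehlerDifferential.mvPolynomialBasis k ι).ofIsLocalizedModule K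
    (nonZeroDivisors (MvPolynomial ι k))
    (KaehlerDifferential.map k k (MvPolynomial ι k) K), fun l => ?_⟩
  rw [Module.Basis.ofIsLocalizedModule_apply, KaehlerDifferential.mvPolynomialBasis_apply,
    KaehlerDifferential.map_D, hmap, MvPolynomial.aeval_X]

lemma derivation_mem_range_of_isLocalization {k A S K : Type*} [CommRing k] [CommRing A]
    [CommRing S] [Field K] [Algebra k K] [Algebra A S] [Algebra S K] [Algebra A K]
    [IsScalarTower A S K] (M : Submonoid A) [IsLocalization M S] (δ : Derivation k K K)
    (hδ : ∀ f : A, δ (algebraMap A K f) ∈ (algebraMap S K).range) (s : S) :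
    δ (algebraMap S K s) ∈ (algebraMap S K).range := by
  obtain ⟨f, g, rfl⟩ := IsLocalization.exists_mk'_eq M s
  obtain ⟨w, hw⟩ := (IsLocalization.map_units S g).exists_right_inv
  have hinv : algebraMap A K g * algebraMap S K w = 1 := by
    rw [IsScalarTower.algebraMap_apply A S K, ← map_mul, hw, map_one]
  have hspec : algebraMap S K (IsLocalization.mk' S f g) = algebraMap A K f / algebraMap A K g := by
    rw [eq_div_iff (left_ne_zero_of_mul_eq_one hinv), IsScalarTower.algebraMap_apply A S K,
      IsScalarTower.algebraMap_apply A S K, ← map_mul, IsLocalization.mk'_spec]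
  have hA (x : A) : algebraMap A K x ∈ (algebraMap S K).range :=
    ⟨algebraMap A S x, (IsScalarTower.algebraMap_apply A S K x).symm⟩
  rw [hspec, Derivation.leibniz_div, smul_eq_mul, smul_eq_mul, smul_eq_mul,
    inv_eq_of_mul_eq_one_right hinv]
  exact mul_mem (pow_mem (RingHom.mem_range_self _ _) 2)
    (sub_mem (mul_mem (hA _) (hδ f)) (mul_mem (hA f) (hδ _)))

/-! ### Coordinates on a chart -/

namespace IsDualBasis
variable {r a : ℕ} {ρ : Fin 3 → Fin 3 → ℚ} {μ : Fin 3 → Fin 3 → ℤ} (h : IsDualBasis r a ρ μ)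

include h in
lemma pair_sum (k : Fin 3 → ℤ) (i : Fin 3) : pair (ρ i) (∑ l, k l • μ l) = k i := by
  simp only [Fin.sum_univ_three, pair_add, pair_zsmul, h.pair_eq]
  fin_cases i <;> simp

variable {τ : Set (Fin 3 → ℚ)} (hτ : τ ⊆ Set.range ρ)
  (K : Type) [Field K] [Algebra ℂ K] [Algebra (chartRing r a τ) K]
  [IsScalarTower ℂ (chartRing r a τ) K] [IsFractionRing (chartRing r a τ) K]

/-- The coordinate functions, as rational functions, of a chart with smooth cone spanned by
part of `ρ`: the characters of the basis dual to `ρ`. -/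
def coord (l : Fin 3) : K := algebraMap (chartRing r a τ) K (chi (μ l) (h.mem_dualMonoid hτ l))

omit [Algebra ℂ K] [IsScalarTower ℂ (chartRing r a τ) K] in
lemma coord_ne_zero (l : Fin 3) : h.coord hτ K l ≠ 0 :=
  (map_ne_zero_iff _ (IsFractionRing.injective (chartRing r a τ) K)).2 (chi_ne_zero _)

omit [Algebra ℂ K] [IsScalarTower ℂ (chartRing r a τ) K]
  [IsFractionRing (chartRing r a τ) K] in
lemma prod_coord_pow (n : Fin 3 → ℕ) :
    ∏ l, h.coord hτ K l ^ n l = algebraMap (chartRing r a τ) K (chi (∑ l, n l • μ l)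
      (sum_mem fun l _ => nsmul_mem (h.mem_dualMonoid hτ l) _)) := by
  simp only [coord, ← map_pow, ← map_prod, chi_pow]
  congr 1
  simp only [Fin.prod_univ_three, chi_mul]
  exact chi_congr (Fin.sum_univ_three fun l => n l • μ l).symm _ _

omit [Algebra ℂ K] [IsScalarTower ℂ (chartRing r a τ) K] in
lemma algebraMap_chi {m : Fin 3 → ℤ} (hm : m ∈ dualMonoid r a τ) {k : Fin 3 → ℤ}
    (hk : m = ∑ l, k l • μ l) :
    algebraMap _ K (chi m hm) = ∏ l, h.coord hτ K l ^ k l := by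
  have hsplit (l) : h.coord hτ K l ^ k l * h.coord hτ K l ^ (-k l).toNat =
      h.coord hτ K l ^ (k l).toNat := by
    rw [← zpow_natCast, ← zpow_natCast, ← zpow_add₀ (h.coord_ne_zero hτ K l)]
    congr 1
    omega
  have hne : ∏ l, h.coord hτ K l ^ (-k l).toNat ≠ 0 :=
    Finset.prod_ne_zero_iff.2 fun l _ => pow_ne_zero _ (h.coord_ne_zero hτ K l)
  rw [← mul_left_inj' hne, ← Finset.prod_mul_distrib, Finset.prod_congr rfl fun l _ => hsplit l,
    h.prod_coord_pow, h.prod_coord_pow, ← map_mul, chi_mul]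
  congr 1
  refine chi_congr ?_ _ _
  rw [hk, ← Finset.sum_add_distrib]
  refine Finset.sum_congr rfl fun l _ => ?_
  rw [← natCast_zsmul, ← natCast_zsmul, ← add_zsmul]
  congr 1
  omega

lemma algebraicIndependent_coord : AlgebraicIndependent ℂ (h.coord hτ K) := by
  have hinj : Function.Injective fun n : Fin 3 →₀ ℕ => ∑ l, n l • μ l := fun n n' hn => by
    ext i
    have hi := congrArg (pair (ρ i)) hn
    simp only [← natCast_zsmul, h.pair_sum _ i] at hi
    exact_mod_cast hi
  have hsingle : AlgebraicIndependent ℂ fun l => (AddMonoidAlgebra.single (μ l) 1 : Laurent) :=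
    fun f g hfg => AddMonoidAlgebra.mapDomain_injective hinj <| by
      rwa [aeval_single_eq_mapDomain, aeval_single_eq_mapDomain] at hfg
  have hchi : AlgebraicIndependent ℂ fun l => chi (μ l) (h.mem_dualMonoid hτ l) :=
    hsingle.of_comp (chartRing r a τ).val
  exact hchi.map' (f := IsScalarTower.toAlgHom ℂ _ K) (IsFractionRing.injective _ K)

lemma adjoin_range_coord : IntermediateField.adjoin ℂ (Set.range (h.coord hτ K)) = ⊤ := by
  have hA (f : chartRing r a τ) :
      algebraMap _ K f ∈ IntermediateField.adjoin ℂ (Set.range (h.coord hτ K)) := by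
    let E := IntermediateField.adjoin ℂ (Set.range (h.coord hτ K))
    let φ := (IsScalarTower.toAlgHom ℂ (chartRing r a τ) K).toLinearMap
    refine mem_submodule_of_chi_mem ((Subalgebra.toSubmodule E.toSubalgebra).comap φ)
      (fun m hm => ?_) f
    obtain ⟨k, -, hk⟩ := h.span m hm.1
    change algebraMap _ K (chi m hm) ∈ E
    rw [h.algebraMap_chi hτ K _ hk]
    exact prod_mem fun l _ =>
      zpow_mem (IntermediateField.subset_adjoin ℂ _ (Set.mem_range_self l)) _
  refine eq_top_iff.2 fun z _ => ?_
  obtain ⟨x, y, -, rfl⟩ := IsFractionRing.div_surjective (A := chartRing r a τ) z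
  exact div_mem (hA x) (hA y)

/-- The basis of the Kähler differentials given by the differentials of the coordinates. -/
def differentialBasis : Module.Basis (Fin 3) K Ω[K⁄ℂ] :=
  (exists_basis_differentials (h.algebraicIndependent_coord hτ K)
    (h.adjoin_range_coord hτ K)).choose

lemma differentialBasis_apply (l : Fin 3) :
    h.differentialBasis hτ K l = KaehlerDifferential.D ℂ K (h.coord hτ K l) :=
  (exists_basis_differentials (h.algebraicIndependent_coord hτ K)
    (h.adjoin_range_coord hτ K)).choose_spec l

/-- The partial derivative with respect to a coordinate. -/
def partialDeriv (l : Fin 3) : Derivation ℂ K K :=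
  ((h.differentialBasis hτ K).coord l).compDer (KaehlerDifferential.D ℂ K)

lemma partialDeriv_coord (l i : Fin 3) :
    h.partialDeriv hτ K l (h.coord hτ K i) = if i = l then 1 else 0 := by
  change (h.differentialBasis hτ K).repr (KaehlerDifferential.D ℂ K (h.coord hτ K i)) l = _
  rw [← differentialBasis_apply, Module.Basis.repr_self, Finsupp.single_apply]

lemma partialDeriv_chi (l : Fin 3) {m : Fin 3 → ℤ} (hm : m ∈ dualMonoid r a τ)
    {k : Fin 3 → ℤ} (hk : m = ∑ l, k l • μ l) :
    h.partialDeriv hτ K l (algebraMap _ K (chi m hm)) =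
      k l * algebraMap _ K (chi m hm) / h.coord hτ K l := by
  have h0 := h.coord_ne_zero hτ K
  simp only [h.algebraMap_chi hτ K hm hk, Fin.prod_univ_three, Derivation.leibniz,
    Derivation.leibniz_zpow, h.partialDeriv_coord, smul_eq_mul, zsmul_eq_mul]
  fin_cases l <;> simp [zpow_sub_one₀ (h0 _)] <;> ring

include h hτ in
lemma sub_mem_dualMonoid {m : Fin 3 → ℤ} (hm : m ∈ dualMonoid r a τ) {k : Fin 3 → ℤ}
    (hk : ∀ l, pair (ρ l) m = k l) {l : Fin 3} (hl : k l ≠ 0) : m - μ l ∈ dualMonoid r a τ := by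
  refine ⟨sub_mem hm.1 (h.mem l), fun v hv => ?_⟩
  obtain ⟨i, rfl⟩ := hτ hv
  have hki : 0 ≤ k i := by exact_mod_cast (hk i).symm ▸ hm.2 _ hv
  rw [sub_eq_add_neg, pair_add, pair_neg, h.pair_eq, hk]
  split_ifs with hil
  · subst hil
    exact_mod_cast (by omega : 0 ≤ k i + -1)
  · simpa using hki

lemma partialDeriv_mem_range (l : Fin 3) (f : chartRing r a τ) :
    h.partialDeriv hτ K l (algebraMap _ K f) ∈ (algebraMap (chartRing r a τ) K).range := by
  let φ := (IsScalarTower.toAlgHom ℂ (chartRing r a τ) K).toLinearMap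
  refine mem_submodule_of_chi_mem ((LinearMap.range φ).comap
    ((h.partialDeriv hτ K l).toLinearMap ∘ₗ φ)) (fun m hm => ?_) f
  change h.partialDeriv hτ K l (algebraMap _ K (chi m hm)) ∈
    (algebraMap (chartRing r a τ) K).range
  obtain ⟨k, hk, hk'⟩ := h.span m hm.1
  rw [h.partialDeriv_chi hτ K l hm hk']
  obtain hl | hl := eq_or_ne (k l) 0
  · rw [hl, Int.cast_zero, zero_mul, zero_div]
    exact zero_mem _
  · have hchi : chi m hm = chi (m - μ l) (h.sub_mem_dualMonoid hτ hm hk hl) *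
        chi (μ l) (h.mem_dualMonoid hτ l) := by
      rw [chi_mul]
      exact chi_congr (sub_add_cancel ..).symm _ _
    rw [hchi, map_mul, mul_div_assoc]
    change _ * (_ * h.coord hτ K l / h.coord hτ K l) ∈ _
    rw [mul_div_cancel_right₀ _ (h.coord_ne_zero hτ K l)]
    exact mul_mem (intCast_mem _ _) ⟨_, rfl⟩

lemma exists_wedge_eq_smul {S : Type*} [CommRing S] [Algebra (chartRing r a τ) S] [Algebra S K]
    [IsScalarTower (chartRing r a τ) S K] (M : Submonoid (chartRing r a τ)) [IsLocalization M S]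
    (c : Fin 3 → S) :
    ∃ s : S, wedge (fun i => algebraMap S K (c i)) = algebraMap S K s • wedge (h.coord hτ K) := by
  have hmem (l i) : h.partialDeriv hτ K l (algebraMap S K (c i)) ∈ (algebraMap S K).range :=
    derivation_mem_range_of_isLocalization M _ (fun f => by
      obtain ⟨g, hg⟩ := h.partialDeriv_mem_range hτ K l f
      rw [← hg, IsScalarTower.algebraMap_apply (chartRing r a τ) S K]
      exact ⟨_, rfl⟩) _
  choose B hB using hmem
  refine ⟨(Matrix.of B).det, ?_⟩
  rw [wedge_eq_det_smul _ (h.differentialBasis_apply hτ K), Module.Basis.det_apply,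
    RingHom.map_det]
  congr 2
  ext l i
  exact (hB l i).symm

lemma wedge_chi {m : Fin 3 → Fin 3 → ℤ} (hm : ∀ j, m j ∈ dualMonoid r a τ)
    {k : Fin 3 → Fin 3 → ℤ} (hk : ∀ j, m j = ∑ l, k j l • μ l) :
    wedge (fun j => algebraMap _ K (chi (m j) (hm j))) =
      (((Matrix.of k).det : K) * (∏ j, algebraMap _ K (chi (m j) (hm j))) /
        ∏ l, h.coord hτ K l) • wedge (h.coord hτ K) := by
  have h0 := h.coord_ne_zero hτ K
  have hmatrix : (h.differentialBasis hτ K).toMatrix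
      (fun j => KaehlerDifferential.D ℂ K (algebraMap _ K (chi (m j) (hm j)))) =
      Matrix.of fun l j => k j l * algebraMap _ K (chi (m j) (hm j)) / h.coord hτ K l := by
    ext l j
    exact h.partialDeriv_chi hτ K l (hm j) (hk j)
  rw [wedge_eq_det_smul _ (h.differentialBasis_apply hτ K), Module.Basis.det_apply, hmatrix]
  congr 1
  simp only [Matrix.det_fin_three, Fin.prod_univ_three, Matrix.of_apply]
  push_cast
  field_simp [h0 0, h0 1, h0 2]
  ring

end IsDualBasis

/-- The prime ideal of a point of `Spec A`, as an ideal of `A` rather than of `CommRingCat.of A`. -/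
def pointIdeal {A : Type} [CommRing A] (p : Spec (CommRingCat.of A)) : Ideal A :=
  PrimeSpectrum.asIdeal (R := A) p

instance {A : Type} [CommRing A] (p : Spec (CommRingCat.of A)) : (pointIdeal p).IsPrime :=
  PrimeSpectrum.isPrime (R := A) p

section chart
variable {Z : Scheme.{0}} {A : Type} [CommRing A] (j : Spec (CommRingCat.of A) ⟶ Z)
  [IsOpenImmersion j] (p : Spec (CommRingCat.of A))

/-- The map from the coordinate ring of a chart to a local ring. -/
def chartStalk : A →+* Z.presheaf.stalk (j p) :=
  (inv (j.stalkMap p)).hom.comp (StructureSheaf.toStalk A p).hom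

lemma stalkMap_chartStalk (f : A) :
    (j.stalkMap p).hom (chartStalk j p f) = (StructureSheaf.toStalk A p).hom f := by
  change (inv (j.stalkMap p) ≫ j.stalkMap p).hom _ = _
  rw [IsIso.inv_hom_id]
  rfl

lemma isLocalization_chartStalk :
    letI := (chartStalk j p).toAlgebra
    IsLocalization.AtPrime (Z.presheaf.stalk (j p)) (pointIdeal p) := by
  let _ := (chartStalk j p).toAlgebra
  let _ : Algebra A ((Spec (CommRingCat.of A)).presheaf.stalk p) :=
    StructureSheaf.stalkAlgebra A p
  have : IsLocalization.AtPrime ((Spec (CommRingCat.of A)).presheaf.stalk p) (pointIdeal p) :=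
    StructureSheaf.IsLocalization.to_stalk A p
  let E : (Spec (CommRingCat.of A)).presheaf.stalk p ≃+* Z.presheaf.stalk (j p) :=
    (asIso (j.stalkMap p)).symm.commRingCatIsoToRingEquiv
  exact IsLocalization.isLocalization_of_algEquiv (pointIdeal p).primeCompl
    (AlgEquiv.ofRingEquiv (f := E) fun _ => rfl)

lemma germ_eq_chartStalk {s : Γ(Z, ⊤)} {f : A}
    (h : j.appTop s = (Scheme.ΓSpecIso (CommRingCat.of A)).inv f) :
    Z.presheaf.germ ⊤ (j p) trivial s = chartStalk j p f := by
  have hinj : Function.Injective (j.stalkMap p).hom :=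
    ((ConcreteCategory.isIso_iff_bijective (j.stalkMap p)).1 inferInstance).1
  apply hinj
  rw [stalkMap_chartStalk]
  refine (Scheme.Hom.germ_stalkMap_apply j ⊤ p trivial s).trans ?_
  have : j.app ⊤ s = (Scheme.ΓSpecIso (CommRingCat.of A)).inv f := h
  rw [this]
  rfl

variable [IsIntegral Z]

/-- The map from the coordinate ring of a chart to the function field. -/
def chartFun : A →+* Z.functionField :=
  (algebraMap (Z.presheaf.stalk (j p)) Z.functionField).comp (chartStalk j p)

lemma germ_eq_chartFun {s : Γ(Z, ⊤)} {f : A}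
    (h : j.appTop s = (Scheme.ΓSpecIso (CommRingCat.of A)).inv f) :
    Z.presheaf.germ ⊤ (genericPoint Z) trivial s = chartFun j p f := by
  have : Nonempty (⊤ : Z.Opens) := ⟨⟨j p, trivial⟩⟩
  rw [chartFun, RingHom.comp_apply, ← germ_eq_chartStalk j p h]
  exact (Scheme.algebraMap_germ_eq_germToFunctionField (X := Z) (U := ⊤) trivial s).symm

omit [IsIntegral Z] in
lemma chartStalk_injective [IsDomain A] : Function.Injective (chartStalk j p) := by
  let _ := (chartStalk j p).toAlgebra
  have := isLocalization_chartStalk j p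
  exact IsLocalization.injective (M := (pointIdeal p).primeCompl) (Z.presheaf.stalk (j p))
    (pointIdeal p).primeCompl_le_nonZeroDivisors

lemma chartFun_injective [IsDomain A] : Function.Injective (chartFun j p) :=
  (IsFractionRing.injective (Z.presheaf.stalk (j p)) Z.functionField).comp
    (chartStalk_injective j p)

lemma isFractionRing_functionField [IsDomain A] :
    letI := (chartFun j p).toAlgebra
    IsFractionRing A Z.functionField := by
  let _ := (chartStalk j p).toAlgebra
  let _ := (chartFun j p).toAlgebra
  have := isLocalization_chartStalk j p
  have : IsScalarTower A (Z.presheaf.stalk (j p)) Z.functionField := .of_algebraMap_eq fun _ => rfl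
  have hcomap : (nonZeroDivisors (Z.presheaf.stalk (j p))).comap
      (algebraMap A (Z.presheaf.stalk (j p))) = nonZeroDivisors A := by
    ext f
    rw [Submonoid.mem_comap, mem_nonZeroDivisors_iff_ne_zero, mem_nonZeroDivisors_iff_ne_zero]
    exact map_ne_zero_iff _ (chartStalk_injective j p)
  rw [IsFractionRing, ← hcomap]
  exact IsLocalization.localization_localization_isLocalization_of_has_all_units
    (pointIdeal p).primeCompl _ _ fun _ hx => hx.mem_nonZeroDivisors

variable [IsLocallyNoetherian Z]

lemma ord_algebraMap_of_isUnit {z : Z} {s : Z.presheaf.stalk z} (hs : IsUnit s) :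
    Scheme.ord (algebraMap (Z.presheaf.stalk z) Z.functionField s) z = 0 := by
  by_cases hz : Order.coheight z = 1
  · have : Ring.KrullDimLE 1 (Z.presheaf.stalk z) := krullDimLE_of_coheight_le hz.le
    have h0 : algebraMap (Z.presheaf.stalk z) Z.functionField s ≠ 0 :=
      (hs.map (algebraMap (Z.presheaf.stalk z) Z.functionField)).ne_zero
    rw [Scheme.ord_eq_iff hz h0]
    exact Ring.ordFrac_of_isUnit hs
  · exact Scheme.ord_eq_zero_of_coheight_neq_one hz _

lemma ord_chartFun_of_isUnit {f : A} (hf : IsUnit f) :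
    Scheme.ord (chartFun j p f) (j p) = 0 :=
  ord_algebraMap_of_isUnit (hf.map (chartStalk j p))

lemma ord_chartFun_pow_mul [IsDomain A] (hz : Order.coheight (j p) = 1) {t : A}
    (hP : pointIdeal p = Ideal.span {t}) (ht : t ≠ 0) (n : ℕ) {g : A} (hg : g ∉ pointIdeal p) :
    Scheme.ord (chartFun j p (t ^ n * g)) (j p) = n := by
  let _ := (chartStalk j p).toAlgebra
  have := isLocalization_chartStalk j p
  have : Ring.KrullDimLE 1 (Z.presheaf.stalk (j p)) := krullDimLE_of_coheight_le hz.le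
  have hg0 : g ≠ 0 := fun h0 => hg (h0 ▸ zero_mem _)
  have hne : t ^ n * g ≠ 0 := mul_ne_zero (pow_ne_zero _ ht) hg0
  rw [Scheme.ord_eq_iff hz ((map_ne_zero_iff _ (chartFun_injective j p)).2 hne)]
  have hs : chartStalk j p (t ^ n * g) ≠ 0 :=
    (map_ne_zero_iff _ (chartStalk_injective j p)).2 hne
  refine (Ring.ordFrac_eq_ord (Z.presheaf.stalk (j p)) hs).trans ?_
  refine Ring.ordMonoidWithZeroHom_eq_coe _ (mem_nonZeroDivisors_iff_ne_zero.2 hs) ?_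
  exact ord_pow_mul (S := Z.presheaf.stalk (j p)) hP
    ((map_ne_zero_iff _ (chartStalk_injective j p)).2 ht) n hg

omit [IsIntegral Z] [IsLocallyNoetherian Z] in
lemma coheight_chart : Order.coheight (j p) = (pointIdeal p).height :=
  (coheight_eq_of_isOpenImmersion j).trans (idealHeight_eq_coheight (CommRingCat.of A) p).symm

end chart

section ord
variable {Z : Scheme.{0}} [IsIntegral Z] [IsLocallyNoetherian Z] (z : Z)

lemma ord_one : Scheme.ord (1 : Z.functionField) z = 0 := by
  have := Scheme.ord_mul (x := z) (one_ne_zero (α := Z.functionField)) one_ne_zero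
  rw [mul_one] at this
  omega

lemma ord_prod {ι : Type*} (s : Finset ι) {f : ι → Z.functionField} (hf : ∀ i, f i ≠ 0) :
    Scheme.ord (∏ i ∈ s, f i) z = ∑ i ∈ s, Scheme.ord (f i) z := by
  induction s using Finset.cons_induction with
  | empty => exact ord_one z
  | cons i s hi ih =>
    rw [Finset.prod_cons, Finset.sum_cons,
      Scheme.ord_mul (hf i) (Finset.prod_ne_zero_iff.2 fun i _ => hf i), ih]

lemma ord_pow {f : Z.functionField} (hf : f ≠ 0) (n : ℕ) :
    Scheme.ord (f ^ n) z = n * Scheme.ord f z := by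
  simpa using ord_prod z (Finset.range n) fun _ => hf

end ord

/-! ### Forms on toric charts -/

lemma pair_single_right (v : Fin 3 → ℚ) (k : Fin 3) (n : ℤ) :
    pair v (Pi.single k n) = v k * n := by
  rw [pair, Finset.sum_eq_single k] <;> simp +contextual

lemma single_mem_dualMonoid {r a : ℕ} {τ : Set (Fin 3 → ℚ)} (hpos : ∀ v ∈ τ, 0 ≤ v)
    (k : Fin 3) : (Pi.single k (r : ℤ) : Fin 3 → ℤ) ∈ dualMonoid r a τ := by
  refine ⟨Finset.dvd_sum fun i _ => dvd_mul_of_dvd_right ?_ _, fun v hv => ?_⟩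
  · obtain rfl | hik := eq_or_ne i k
    · rw [Pi.single_eq_same]
    · rw [Pi.single_eq_of_ne hik]
      exact dvd_zero _
  · rw [pair_single_right]
    exact mul_nonneg (hpos v hv k) (by positivity)

section toricChart
variable {r a : ℕ} {τ : Set (Fin 3 → ℚ)} {Z : Scheme.{0}} [IsIntegral Z]
  {π : Z ⟶ Spec (CommRingCat.of ℂ)} {j : Spec (CommRingCat.of (chartRing r a τ)) ⟶ Z}
  [IsOpenImmersion j]
  (hπ : j ≫ π = Spec.map (CommRingCat.ofHom (algebraMap ℂ (chartRing r a τ))))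
  (p : Spec (CommRingCat.of (chartRing r a τ)))

include hπ in
lemma scalars_eq_chartFun (c : ℂ) : scalars π c = chartFun j p (algebraMap ℂ _ c) := by
  refine germ_eq_chartFun j p ?_
  change (π.appTop ≫ j.appTop) _ = _
  rw [← Scheme.Hom.comp_appTop, hπ]
  exact ConcreteCategory.congr_hom (Scheme.ΓSpecIso_inv_naturality
    (CommRingCat.ofHom (algebraMap ℂ (chartRing r a τ)))).symm c

variable [IsLocallyNoetherian Z]

omit hπ in
lemma ord_intCast {n : ℤ} (hn : n ≠ 0) : Scheme.ord (n : Z.functionField) (j p) = 0 := by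
  have hunit : IsUnit (n : chartRing r a τ) := by
    rw [← map_intCast (algebraMap ℂ (chartRing r a τ))]
    exact (IsUnit.mk0 (n : ℂ) (Int.cast_ne_zero.2 hn)).map _
  rw [← map_intCast (chartFun j p)]
  exact ord_chartFun_of_isUnit j p hunit

variable {ρ : Fin 3 → Fin 3 → ℚ} {μ : Fin 3 → Fin 3 → ℤ} (h : IsDualBasis r a ρ μ)
  (hτ : τ ⊆ Set.range ρ)

include hπ in
lemma hasFormOrder_chi {m : Fin 3 → Fin 3 → ℤ} (hm : ∀ i, m i ∈ dualMonoid r a τ)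
    (hdet : (Matrix.of m).det ≠ 0) :
    HasFormOrder π (fun i => chartFun j p (chi (m i) (hm i))) (j p)
      (∑ i, Scheme.ord (chartFun j p (chi (m i) (hm i))) (j p) -
        ∑ l, Scheme.ord (chartFun j p (chi (μ l) (h.mem_dualMonoid hτ l))) (j p)) := by
  let _ : Algebra ℂ Z.functionField := (scalars π).toAlgebra
  let _ := (chartStalk j p).toAlgebra
  let _ := (chartFun j p).toAlgebra
  have := isLocalization_chartStalk j p
  have := isFractionRing_functionField j p
  have : IsScalarTower ℂ (chartRing r a τ) Z.functionField :=
    .of_algebraMap_eq (scalars_eq_chartFun hπ p)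
  have : IsScalarTower (chartRing r a τ) (Z.presheaf.stalk (j p)) Z.functionField :=
    .of_algebraMap_eq fun _ => rfl
  choose k _ hk using fun i => h.span _ (hm i).1
  have hdetk : (Matrix.of k).det ≠ 0 := by
    have hmul : Matrix.of m = Matrix.of k * Matrix.of μ := by
      ext i l
      simp [hk, Matrix.mul_apply]
    rw [hmul, Matrix.det_mul] at hdet
    exact left_ne_zero_of_mul hdet
  have hchi (n : Fin 3 → ℤ) (hn : n ∈ dualMonoid r a τ) : chartFun j p (chi n hn) ≠ 0 :=
    (map_ne_zero_iff _ (chartFun_injective j p)).2 (chi_ne_zero _)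
  have hdetK : ((Matrix.of k).det : Z.functionField) ≠ 0 := by
    have := charZero_of_injective_algebraMap (algebraMap ℂ Z.functionField).injective
    exact Int.cast_ne_zero.2 hdetk
  have hprodm := Finset.prod_ne_zero_iff.2 fun i (_ : i ∈ Finset.univ) => hchi _ (hm i)
  have hprodμ := Finset.prod_ne_zero_iff.2 fun l (_ : l ∈ Finset.univ) =>
    hchi _ (h.mem_dualMonoid hτ l)
  have hu := div_ne_zero (mul_ne_zero hdetK hprodm) hprodμ
  refine ⟨fun l => chartStalk j p (chi (μ l) (h.mem_dualMonoid hτ l)),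
    h.exists_wedge_eq_smul hτ _ (pointIdeal p).primeCompl,
    ((Matrix.of k).det : Z.functionField) * (∏ i, chartFun j p (chi (m i) (hm i))) /
      ∏ l, chartFun j p (chi (μ l) (h.mem_dualMonoid hτ l)), h.wedge_chi hτ _ hm hk, ?_, ?_⟩
  · refine ne_of_eq_of_ne (h.wedge_chi hτ _ hm hk) (smul_ne_zero hu ?_)
    exact wedge_ne_zero _ (h.differentialBasis_apply hτ _)
  · rw [eq_sub_iff_add_eq, ← ord_prod _ _ fun l => hchi _ (h.mem_dualMonoid hτ l),
      ← ord_prod _ _ fun i => hchi _ (hm i), ← Scheme.ord_mul hu hprodμ, div_mul_cancel₀ _ hprodμ,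
      Scheme.ord_mul hdetK hprodm, ord_intCast p hdetk, zero_add]

include hπ in
/-- The form `f (d(x ^ r) ∧ d(y ^ r) ∧ d(z ^ r))^{⊗ r}` with `f = (xyz) ^ (-r (r - 1))` is the
constant `r ^ (3r)` times `(dx ∧ dy ∧ dz)^{⊗ r}`, which generates the `r`-canonical sheaf of `X`. -/
lemma hasPluriformOrder_chart (hr : 0 < r) (hpos : ∀ v ∈ τ, 0 ≤ v) {b : Fin 3 → Z.functionField}
    (hb : ∀ k, b k = chartFun j p (chi _ (single_mem_dualMonoid hpos k)))
    {f : Z.functionField} (hf : f * (∏ k, b k) ^ (r - 1) = 1) :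
    HasPluriformOrder π r f b (j p) (∑ k, Scheme.ord (b k) (j p) -
      r * ∑ l, Scheme.ord (chartFun j p (chi (μ l) (h.mem_dualMonoid hτ l))) (j p)) := by
  have hb0 (k) : b k ≠ 0 := by
    rw [hb, map_ne_zero_iff _ (chartFun_injective j p)]
    exact chi_ne_zero _
  have hprod : ∏ k, b k ≠ 0 := Finset.prod_ne_zero_iff.2 fun k _ => hb0 k
  have hf0 : f ≠ 0 := left_ne_zero_of_mul_eq_one hf
  have hordf : Scheme.ord f (j p) + (r - 1) * ∑ k, Scheme.ord (b k) (j p) = 0 := by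
    rw [← ord_one (j p), ← hf, Scheme.ord_mul hf0 (pow_ne_zero _ hprod), ord_pow _ hprod,
      ord_prod _ _ hb0, Nat.cast_pred hr]
  have hdet : (Matrix.of fun k : Fin 3 => (Pi.single k (r : ℤ) : Fin 3 → ℤ)).det ≠ 0 := by
    simp [Matrix.det_fin_three, hr.ne']
  have hform := hasFormOrder_chi hπ p h hτ (single_mem_dualMonoid (a := a) hpos) hdet
  simp only [← hb] at hform
  exact ⟨hf0, _, hform, by linear_combination -hordf⟩

end toricChart

/-! ### The divisor of a ray -/

/-- The generic point of the torus invariant divisor of `v` in the chart of the cone spanned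
by `v`. -/
def rayPoint (r a : ℕ) (v : Fin 3 → ℚ) : Spec (CommRingCat.of (chartRing r a {v})) :=
  (⟨divisorIdeal r a (Set.mem_singleton v), inferInstance⟩ : PrimeSpectrum (chartRing r a {v}))

namespace IsDualBasis
variable {r a : ℕ} {ρ : Fin 3 → Fin 3 → ℚ} {μ : Fin 3 → Fin 3 → ℤ} (h : IsDualBasis r a ρ μ)
  (l : Fin 3) [IsNoetherianRing (chartRing r a {ρ l})]
  {Z : Scheme.{0}} (j : Spec (CommRingCat.of (chartRing r a {ρ l})) ⟶ Z) [IsOpenImmersion j]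
include h

lemma coheight_rayPoint : Order.coheight (j (rayPoint r a (ρ l))) = 1 :=
  (coheight_chart j _).trans (height_eq_one_of_eq_span (h.divisorIdeal_eq_span l) (chi_ne_zero _))

variable [IsIntegral Z] [IsLocallyNoetherian Z]

lemma isLeast_ord_rayPoint {f : chartRing r a {ρ l}} (hf : f ≠ 0) :
    IsLeast (pair (ρ l) '' f.1.coeff.support)
      (Scheme.ord (chartFun j (rayPoint r a (ρ l)) f) (j (rayPoint r a (ρ l))) : ℚ) := by
  obtain ⟨n, g, hg, hfg, hn⟩ := h.exists_eq_pow_mul l hf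
  have hord := ord_chartFun_pow_mul j (rayPoint r a (ρ l)) (h.coheight_rayPoint l j)
    (h.divisorIdeal_eq_span l) (chi_ne_zero _) n hg
  rw [← hfg] at hord
  rwa [hord, Int.cast_natCast]

lemma ord_chi_rayPoint {m : Fin 3 → ℤ} (hm : m ∈ dualMonoid r a {ρ l}) :
    (Scheme.ord (chartFun j (rayPoint r a (ρ l)) (chi m hm)) (j (rayPoint r a (ρ l))) : ℚ) =
      pair (ρ l) m := by
  have hleast := h.isLeast_ord_rayPoint l j (chi_ne_zero hm)
  rw [support_chi, Finset.coe_singleton, Set.image_singleton] at hleast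
  exact hleast.1

end IsDualBasis

section fan
variable {r a : ℕ}

variable (r a) in
lemma index_pos [IsTerminalType r a] : 0 < r :=
  (IsTerminalType.pos (r := r) (a := a)).trans IsTerminalType.lt

/-- `v` is the primitive generator of a ray of the fan of the economic resolution. -/
def IsRay (r a : ℕ) (v : Fin 3 → ℚ) : Prop := v ∈ raysOf (fanMax r a)

namespace IsRay
variable {v : Fin 3 → ℚ} (hv : IsRay r a v)

/-- The one-dimensional cone spanned by a ray. -/
abbrev cone : Fan r a :=
  ⟨{v}, hv.choose, hv.choose_spec.1, Set.singleton_subset_iff.2 hv.choose_spec.2⟩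

variable [IsTerminalType r a]

include hv in
lemma isNoetherianRing_chartRing : IsNoetherianRing (chartRing r a {v}) :=
  isNoetherianRing_of_fg (chartRing_fg r a hv.cone)

include hv in
lemma exists_isDualBasis : ∃ ρ μ, ∃ l, IsDualBasis r a ρ μ ∧ ρ l = v := by
  obtain ⟨ρ, μ, h, hτ⟩ := exists_isDualBasis_fan hv.cone
  obtain ⟨l, hl⟩ := hτ (Set.mem_singleton v)
  exact ⟨ρ, μ, l, h, hl⟩

section openImmersion
variable {Z : Scheme.{0}} (j : Spec (CommRingCat.of (chartRing r a {v})) ⟶ Z) [IsOpenImmersion j]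
include hv

lemma coheight_rayPoint : Order.coheight (j (rayPoint r a v)) = 1 := by
  have := hv.isNoetherianRing_chartRing
  obtain ⟨ρ, μ, l, h, rfl⟩ := hv.exists_isDualBasis
  exact h.coheight_rayPoint l j

lemma isLeast_ord_rayPoint [IsIntegral Z] [IsLocallyNoetherian Z] {f : chartRing r a {v}}
    (hf : f ≠ 0) : IsLeast (pair v '' f.1.coeff.support)
      (Scheme.ord (chartFun j (rayPoint r a v) f) (j (rayPoint r a v)) : ℚ) := by
  have := hv.isNoetherianRing_chartRing
  obtain ⟨ρ, μ, l, h, rfl⟩ := hv.exists_isDualBasis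
  exact h.isLeast_ord_rayPoint l j hf

end openImmersion

/-- The generic point of the prime divisor on the economic resolution given by a ray. -/
def divisor : economicResolution r a := chartι r a hv.cone (rayPoint r a v)

lemma coheight_divisor : Order.coheight hv.divisor = 1 :=
  hv.coheight_rayPoint (chartι r a hv.cone)

end IsRay

variable [IsTerminalType r a]

lemma isRay_single (k : Fin 3) : IsRay r a (Pi.single k 1) := by
  rw [IsRay, raysOf_fanMax]
  exact Or.inl ⟨k, rfl⟩

lemma isRay_divisorWeight {i : ℕ} (hi : i ∈ Set.Ico 1 r) : IsRay r a (divisorWeight r a i) := by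
  rw [IsRay, raysOf_fanMax]
  exact Or.inr ⟨i, hi, rfl⟩

/-! ### The resolution on charts -/

lemma chartι_resolution (τ : Fan r a) : chartι r a τ ≫ resolution r a =
    Spec.map (CommRingCat.ofHom (toChart r a τ).toRingHom) :=
  colimit.ι_desc _ _

lemma appTop_chartι_resolution (τ : Fan r a) (g : invariants r a) :
    (chartι r a τ ≫ resolution r a).appTop
        ((Scheme.ΓSpecIso (CommRingCat.of (invariants r a))).inv g) =
      (Scheme.ΓSpecIso (CommRingCat.of (chartRing r a τ.1))).inv (toChart r a τ g) := by
  rw [chartι_resolution]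
  exact ConcreteCategory.congr_hom (Scheme.ΓSpecIso_inv_naturality
    (CommRingCat.ofHom (toChart r a τ).toRingHom)).symm g

lemma chartι_resolution_structX (τ : Fan r a) :
    (chartι r a τ ≫ resolution r a) ≫ structX r a =
      Spec.map (CommRingCat.ofHom (algebraMap ℂ (chartRing r a τ.1))) := by
  rw [chartι_resolution, structX, ← Spec.map_comp, ← CommRingCat.ofHom_comp]
  congr 2
  exact (toChart r a τ).comp_algebraMap

lemma pullbackFunction_eq_chartFun (τ : Fan r a) (x : Spec (CommRingCat.of (chartRing r a τ.1)))
    (g : invariants r a) :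
    pullbackFunction r a g = chartFun (chartι r a τ) x (toChart r a τ g) :=
  germ_eq_chartFun (chartι r a τ) x (appTop_chartι_resolution τ g)

lemma chartι_face {τ σ : Fan r a} (h : τ ≤ σ) (x : Spec (CommRingCat.of (chartRing r a τ.1))) :
    chartι r a σ (Spec.map (CommRingCat.ofHom (faceHom h)) x) = chartι r a τ x := by
  have hface : (diagram r a).map (homOfLE h) ≫ chartι r a σ = chartι r a τ :=
    colimit.w (diagram r a) (homOfLE h)
  exact congrArg (fun f => f x) hface

lemma exists_of_coheight_eq_one {y : economicResolution r a} (hy : Order.coheight y = 1) :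
    (∃ Q, chartι r a (Fan.zero r a) Q = y) ∨ ∃ v, ∃ hv : IsRay r a v, hv.divisor = y := by
  obtain ⟨τ, x, rfl⟩ := chartι_surj r a y
  have h0 : Fan.zero r a ≤ τ := Set.empty_subset _
  obtain ⟨m, hm, -, hpos⟩ := exists_face h0
  rcases exists_face_of_height_eq_one τ.finite hm (fun v hv => hpos v hv (Set.notMem_empty v)) x
    ((coheight_chart (chartι r a τ) x).symm.trans hy) with ⟨Q, rfl⟩ | ⟨v, hv, rfl⟩
  · exact Or.inl ⟨Q, (chartι_face h0 Q).symm⟩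
  · obtain ⟨c, hc, hcτ⟩ := τ.2
    have hray : IsRay r a v := ⟨c, hc, hcτ hv⟩
    have hle : hray.cone ≤ τ := Set.singleton_subset_iff.2 hv
    exact Or.inr ⟨v, hray, (chartι_face hle (rayPoint r a v)).symm⟩

variable (r a) in
/-- The identification of the chart of the octant with `X`. -/
def octantι : Spec (CommRingCat.of (chartRing r a octant)) ⟶ quotient r a :=
  Spec.map (CommRingCat.ofHom (octantEquiv r a).toRingEquiv.toRingHom)

instance : IsIso (octantι r a) := by
  have : IsIso (CommRingCat.ofHom (octantEquiv r a).toRingEquiv.toRingHom) :=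
    (octantEquiv r a).toRingEquiv.toCommRingCatIso.isIso_hom
  exact inferInstanceAs (IsIso (Spec.map _))

lemma chartι_resolution_eq_octantι (τ : Fan r a) (hτ : τ.1 ⊆ octant) :
    chartι r a τ ≫ resolution r a =
      Spec.map (CommRingCat.ofHom (faceHom hτ)) ≫ octantι r a := by
  rw [chartι_resolution, octantι, ← Spec.map_comp, ← CommRingCat.ofHom_comp, toChart_eq τ hτ]

lemma isOpenImmersion_faceHom {τ : Set (Fin 3 → ℚ)} (hτ : τ ⊆ octant) :
    IsOpenImmersion (Spec.map (CommRingCat.ofHom (faceHom (r := r) (a := a) hτ))) := by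
  classical
  let m : Fin 3 → ℤ := fun k => if (Pi.single k 1 : Fin 3 → ℚ) ∈ τ then 0 else r
  have hm : m ∈ latticeM r a := by
    refine Finset.dvd_sum (f := fun i => weight a i * m i) fun i _ => Dvd.dvd.mul_left ?_ _
    simp only [m]
    split_ifs <;> simp
  have h0 : ∀ v ∈ τ, pair v m = 0 := by
    intro v hv
    obtain ⟨k, rfl⟩ := hτ hv
    simp only [pair_single, m, if_pos hv, Int.cast_zero]
  have h1 : ∀ v ∈ octant, v ∉ τ → 1 ≤ pair v m := by
    rintro _ ⟨k, rfl⟩ hv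
    simp only [pair_single, m, if_neg hv]
    exact_mod_cast index_pos r a
  let _ := (faceHom (r := r) (a := a) hτ).toAlgebra
  have : IsLocalization.Away (chi m (face_mem hm h0 h1)) (chartRing r a τ) :=
    isLocalization_face hτ hm h0 h1 (face_mem hm h0 h1) (Set.finite_range _)
  exact IsOpenImmersion.of_isLocalization (chi m (face_mem hm h0 h1))

lemma isOpenImmersion_chartι_resolution (τ : Fan r a) (hτ : τ.1 ⊆ octant) :
    IsOpenImmersion (chartι r a τ ≫ resolution r a) := by
  rw [chartι_resolution_eq_octantι τ hτ]
  have := isOpenImmersion_faceHom (r := r) (a := a) hτ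
  infer_instance

lemma coheight_resolution_chartι (τ : Fan r a) (hτ : τ.1 ⊆ octant)
    (x : Spec (CommRingCat.of (chartRing r a τ.1))) :
    Order.coheight (resolution r a (chartι r a τ x)) = Order.coheight (chartι r a τ x) := by
  have := isOpenImmersion_chartι_resolution τ hτ
  rw [← Scheme.Hom.comp_apply, coheight_chart, coheight_chart]

variable (r a) in
lemma resolution_genericPoint :
    resolution r a (genericPoint (economicResolution r a)) = genericPoint (quotient r a) := by
  have := isOpenImmersion_chartι_resolution (Fan.zero r a) (Set.empty_subset _)
  rw [← genericPoint_eq_of_isOpenImmersion (chartι r a (Fan.zero r a)), ← Scheme.Hom.comp_apply,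
    genericPoint_eq_of_isOpenImmersion]

lemma singleton_subset_octant (k : Fin 3) : {(Pi.single k 1 : Fin 3 → ℚ)} ⊆ octant :=
  Set.singleton_subset_iff.2 ⟨k, rfl⟩

lemma exists_of_coheight_eq_one_quotient {x : quotient r a} (hx : Order.coheight x = 1) :
    (∃ Q, resolution r a (chartι r a (Fan.zero r a) Q) = x) ∨
      ∃ k, resolution r a (isRay_single k).divisor = x := by
  obtain ⟨x, rfl⟩ := (octantι r a).surjective x
  have hm : (fun _ => (r : ℤ)) ∈ latticeM r a :=
    Finset.dvd_sum (f := fun i => weight a i * (r : ℤ)) fun i _ => Dvd.intro_left _ rfl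
  have hpos : ∀ v ∈ octant, 1 ≤ pair v (fun _ => (r : ℤ)) := by
    rintro _ ⟨k, rfl⟩
    rw [pair_single]
    exact_mod_cast index_pos r a
  rcases exists_face_of_height_eq_one (Set.finite_range _) hm hpos x
    ((coheight_chart (octantι r a) x).symm.trans hx) with ⟨Q, rfl⟩ | ⟨_, ⟨k, rfl⟩, rfl⟩
  · exact Or.inl ⟨Q, congrArg (fun f => f Q)
      (chartι_resolution_eq_octantι (Fan.zero r a) (Set.empty_subset _))⟩
  · exact Or.inr ⟨k, congrArg (fun f => f (rayPoint r a (Pi.single k 1)))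
      (chartι_resolution_eq_octantι (isRay_single k).cone (singleton_subset_octant k))⟩

end fan

/-! ### The pluricanonical form -/

section pluricanonical
variable {r a : ℕ} [IsTerminalType r a]

variable (r a) in
/-- The invariant function `x ^ r`, `y ^ r` or `z ^ r`. -/
def coordPow (k : Fin 3) : invariants r a :=
  ⟨MvPolynomial.monomial (Finsupp.single k r) 1, by
    rw [mem_invariants]
    intro m hm
    rw [Finset.mem_singleton.1 (MvPolynomial.support_monomial_subset hm)]
    refine Finset.dvd_sum fun i _ => dvd_mul_of_dvd_right ?_ _
    rw [Finsupp.single_apply]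
    split_ifs <;> simp⟩

lemma support_coordPow (k : Fin 3) : (coordPow r a k).1.support = {Finsupp.single k r} := by
  classical
  rw [coordPow, MvPolynomial.support_monomial, if_neg one_ne_zero]

lemma coordPow_ne_zero (k : Fin 3) : coordPow r a k ≠ 0 := by
  simp [coordPow, Subtype.ext_iff]

lemma toChart_coordPow (τ : Fan r a) (k : Fin 3) : toChart r a τ (coordPow r a k) =
    chi _ (single_mem_dualMonoid (fun _ hv => nonneg_of_mem_fan τ hv) k) := by
  apply Subtype.ext
  change toLaurent (coordPow r a k).1 = AddMonoidAlgebra.single (Pi.single k (r : ℤ)) 1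
  rw [coordPow, toLaurent_monomial]
  congr 1
  funext i
  rw [Finsupp.single_apply, Pi.single_apply]
  split_ifs <;> simp_all

section chart
variable {Z : Scheme.{0}} [IsIntegral Z] [IsLocallyNoetherian Z]
  (π : Z ⟶ Spec (CommRingCat.of ℂ)) {b : Fin 3 → Z.functionField} {f : Z.functionField}

lemma hasPluriformOrder_torus (j : Spec (CommRingCat.of (chartRing r a ∅)) ⟶ Z)
    [IsOpenImmersion j] (hπ : j ≫ π = Spec.map (CommRingCat.ofHom (algebraMap ℂ _)))
    (p : Spec (CommRingCat.of (chartRing r a ∅)))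
    (hb : ∀ k, b k = chartFun j p (toChart r a (Fan.zero r a) (coordPow r a k)))
    (hf : f * (∏ k, b k) ^ (r - 1) = 1) :
    HasPluriformOrder π r f b (j p) 0 := by
  obtain ⟨ρ, μ, h, hτ⟩ := exists_isDualBasis_fan (Fan.zero r a)
  have hord {m : Fin 3 → ℤ} (hm : m ∈ dualMonoid r a ∅) :
      Scheme.ord (chartFun j p (chi m hm)) (j p) = 0 :=
    ord_chartFun_of_isUnit j p (isUnit_chi hm ⟨neg_mem hm.1, by simp⟩)
  have hpos : ∀ v ∈ (∅ : Set (Fin 3 → ℚ)), 0 ≤ v := fun _ hv => hv.elim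
  have hchi (k : Fin 3) : b k = chartFun j p (chi _ (single_mem_dualMonoid hpos k)) :=
    (hb k).trans (congrArg (chartFun j p) (toChart_coordPow _ k))
  convert hasPluriformOrder_chart hπ p h hτ (index_pos r a) hpos hchi hf
  simp_rw [hchi, hord, Finset.sum_const_zero, mul_zero, sub_zero]

lemma IsRay.hasPluriformOrder {v : Fin 3 → ℚ} (hv : IsRay r a v)
    (j : Spec (CommRingCat.of (chartRing r a {v})) ⟶ Z) [IsOpenImmersion j]
    (hπ : j ≫ π = Spec.map (CommRingCat.ofHom (algebraMap ℂ _)))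
    (hb : ∀ k, b k = chartFun j (rayPoint r a v) (toChart r a hv.cone (coordPow r a k)))
    (hf : f * (∏ k, b k) ^ (r - 1) = 1) {n : ℤ} (hn : (n : ℚ) = r * (∑ k, v k - 1)) :
    HasPluriformOrder π r f b (j (rayPoint r a v)) n := by
  have := hv.isNoetherianRing_chartRing
  obtain ⟨ρ, μ, l, h, rfl⟩ := hv.exists_isDualBasis
  have hpos : ∀ v ∈ ({ρ l} : Set (Fin 3 → ℚ)), 0 ≤ v :=
    fun _ hv' => nonneg_of_mem_fan hv.cone hv'
  have hchi (k : Fin 3) := (hb k).trans (congrArg (chartFun j _) (toChart_coordPow _ k))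
  convert hasPluriformOrder_chart hπ (rayPoint r a (ρ l)) h (Set.singleton_subset_iff.2 ⟨l, rfl⟩)
    (index_pos r a) hpos hchi hf
  rw [← Int.cast_inj (α := ℚ), hn]
  push_cast
  simp_rw [hchi, h.ord_chi_rayPoint, pair_single_right, h.pair_eq, Finset.sum_ite_eq,
    Finset.mem_univ, if_true, ← Finset.sum_mul]
  push_cast
  ring

end chart

end pluricanonical

/-! ### Discrepancies and centres of the divisors -/

lemma isUnit_germ_of_eq_genericPoint {X : Scheme.{0}} [IsIntegral X] {x : X}
    (hx : x = genericPoint X) {s : Γ(X, ⊤)} (hs : s ≠ 0) :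
    IsUnit (X.presheaf.germ ⊤ x trivial s) := by
  subst hx
  exact (isUnit_iff_ne_zero (G₀ := X.functionField)).2
    ((map_ne_zero_iff _ (germ_injective_of_isIntegral X (U := ⊤) _ trivial)).2 hs)

section divisors
variable {r a : ℕ} [IsTerminalType r a]

variable (r a) in
/-- The germ of an invariant function at the image of the generic point of the resolution, the
stalk in which `HasDiscrepancy` looks for a generator of the pluricanonical forms. -/
def genericGerm :
    invariants r a →+*
      (quotient r a).presheaf.stalk (resolution r a (genericPoint (economicResolution r a))) :=
  ((quotient r a).presheaf.germ ⊤ _ trivial).hom.comp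
    (Scheme.ΓSpecIso (CommRingCat.of (invariants r a))).inv.hom

lemma stalkMap_genericGerm (g : invariants r a) :
    ((resolution r a).stalkMap (genericPoint (economicResolution r a))).hom (genericGerm r a g) =
      pullbackFunction r a g :=
  Scheme.Hom.germ_stalkMap_apply (resolution r a) ⊤ _ trivial _

lemma algebraMap_genericGerm (τ : Fan r a) [IsOpenImmersion (chartι r a τ ≫ resolution r a)]
    (x : Spec (CommRingCat.of (chartRing r a τ.1))) (g : invariants r a) :
    algebraMap _ (quotient r a).functionField (genericGerm r a g) =
      chartFun (chartι r a τ ≫ resolution r a) x (toChart r a τ g) := by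
  have : Nonempty (⊤ : (quotient r a).Opens) := ⟨⟨genericPoint (quotient r a), trivial⟩⟩
  exact (Scheme.algebraMap_germ_eq_germToFunctionField (X := quotient r a) (U := ⊤) trivial _).trans
    (germ_eq_chartFun _ x (appTop_chartι_resolution τ g))

lemma isUnit_genericGerm {g : invariants r a} (hg : g ≠ 0) : IsUnit (genericGerm r a g) := by
  have hinj : Function.Injective (Scheme.ΓSpecIso (CommRingCat.of (invariants r a))).inv :=
    ((ConcreteCategory.isIso_iff_bijective _).1 inferInstance).1
  exact isUnit_germ_of_eq_genericPoint (resolution_genericPoint r a)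
    ((map_ne_zero_iff _ hinj).2 hg)

variable (r a) in
lemma exists_mul_genericGerm_eq_one :
    ∃ f, f * (∏ k, genericGerm r a (coordPow r a k)) ^ (r - 1) = 1 := by
  rw [← map_prod, ← map_pow]
  exact (isUnit_genericGerm (pow_ne_zero _
    (Finset.prod_ne_zero_iff.2 fun k _ => coordPow_ne_zero k))).exists_left_inv

lemma hasPluriformOrder_quotient {f}
    (hf : f * (∏ k, genericGerm r a (coordPow r a k)) ^ (r - 1) = 1)
    {x : quotient r a} (hx : Order.coheight x = 1) :
    HasPluriformOrder (structX r a) r (algebraMap _ (quotient r a).functionField f)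
      (fun k => algebraMap _ (quotient r a).functionField (genericGerm r a (coordPow r a k)))
      x 0 := by
  have hf' := congrArg (algebraMap _ (quotient r a).functionField) hf
  rw [map_mul, map_pow, map_prod, map_one] at hf'
  rcases exists_of_coheight_eq_one_quotient hx with ⟨Q, rfl⟩ | ⟨k, rfl⟩
  · let j : Spec (CommRingCat.of (chartRing r a ∅)) ⟶ quotient r a :=
      chartι r a (Fan.zero r a) ≫ resolution r a
    have : IsOpenImmersion j :=
      isOpenImmersion_chartι_resolution (Fan.zero r a) (Set.empty_subset _)
    exact hasPluriformOrder_torus (structX r a) j (chartι_resolution_structX (Fan.zero r a)) Q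
      (fun _ => haveI : IsOpenImmersion (chartι r a (Fan.zero r a) ≫ resolution r a) := this
        algebraMap_genericGerm (Fan.zero r a) Q _) hf'
  · have hk : IsRay r a (Pi.single k 1) := isRay_single k
    have := isOpenImmersion_chartι_resolution hk.cone (singleton_subset_octant k)
    exact hk.hasPluriformOrder _ _ (chartι_resolution_structX hk.cone)
      (fun _ => algebraMap_genericGerm hk.cone _ _) hf' (by simp)

namespace IsRay
variable {v : Fin 3 → ℚ} (hv : IsRay r a v)
include hv

lemma hasDiscrepancy {n : ℤ} (hn : (n : ℚ) = r * (∑ k, v k - 1)) :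
    HasDiscrepancy (structX r a) (resolution r a) hv.divisor (∑ k, v k - 1) := by
  obtain ⟨f, hf⟩ := exists_mul_genericGerm_eq_one r a
  have hf' := congrArg ((resolution r a).stalkMap (genericPoint (economicResolution r a))).hom hf
  rw [map_mul, map_pow, map_prod, map_one] at hf'
  have hj : chartι r a hv.cone ≫ resolution r a ≫ structX r a =
      Spec.map (CommRingCat.ofHom (algebraMap ℂ _)) :=
    (Category.assoc ..).symm.trans (chartι_resolution_structX hv.cone)
  refine ⟨r, f, fun k => genericGerm r a (coordPow r a k), n, index_pos r a,
    fun x hx _ => hasPluriformOrder_quotient hf hx, ?_, hn⟩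
  refine hv.hasPluriformOrder _ _ hj (fun k => ?_) hf' hn
  rw [stalkMap_genericGerm]
  exact pullbackFunction_eq_chartFun hv.cone _ _

lemma isLeast_ord_divisor {g : invariants r a} (hg : g ≠ 0) :
    IsLeast ((fun m : Fin 3 →₀ ℕ => ∑ k, v k * m k) '' g.1.support)
      (Scheme.ord (pullbackFunction r a g) hv.divisor : ℚ) := by
  have hg' : toChart r a hv.cone g ≠ 0 := fun h0 => hg <| Subtype.ext <|
    toLaurent_injective <| (congrArg Subtype.val h0).trans (map_zero _).symm
  have hsupp : (fun m : Fin 3 →₀ ℕ => ∑ k, v k * m k) '' (g.1.support : Set (Fin 3 →₀ ℕ)) =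
      pair v '' ((toChart r a hv.cone g).1.coeff.support : Set (Fin 3 → ℤ)) := by
    change _ = pair v '' ((toLaurent g.1).coeff.support : Set (Fin 3 → ℤ))
    rw [support_toLaurent, Set.image_image]
    simp only [pair, Int.cast_natCast]
  rw [hsupp, pullbackFunction_eq_chartFun hv.cone (rayPoint r a v)]
  exact hv.isLeast_ord_rayPoint (chartι r a hv.cone) hg'

lemma ord_coordPow_divisor (k : Fin 3) :
    (Scheme.ord (pullbackFunction r a (coordPow r a k)) hv.divisor : ℚ) = v k * r := by
  have hleast := hv.isLeast_ord_divisor (coordPow_ne_zero k)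
  rw [support_coordPow, Finset.coe_singleton, Set.image_singleton] at hleast
  rw [Set.mem_singleton_iff.1 hleast.1]
  simp [Finsupp.single_apply]

end IsRay

omit [IsTerminalType r a] in
lemma mem_comap_divisorIdeal {σ : Set (Fin 3 → ℚ)} {v : Fin 3 → ℚ} (hv : v ∈ σ)
    {φ : invariants r a →+* chartRing r a σ} (hφ : ∀ g, (φ g).1 = toLaurent g.1)
    {g : invariants r a} :
    g ∈ (divisorIdeal r a hv).comap φ ↔ ∀ m ∈ g.1.support, 0 < ∑ k, v k * m k := by
  change (∀ m ∈ ((φ g).1.coeff.support : Set (Fin 3 → ℤ)), 0 < pair v m) ↔ _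
  rw [hφ, support_toLaurent, Set.forall_mem_image]
  simp only [Finset.mem_coe, pair, Int.cast_natCast]

lemma coordPow_mem_comap_divisorIdeal {σ : Set (Fin 3 → ℚ)} {v : Fin 3 → ℚ} (hv : v ∈ σ)
    {φ : invariants r a →+* chartRing r a σ} (hφ : ∀ g, (φ g).1 = toLaurent g.1) (k : Fin 3) :
    coordPow r a k ∈ (divisorIdeal r a hv).comap φ ↔ 0 < v k := by
  have hr : (0 : ℚ) < r := mod_cast index_pos r a
  rw [mem_comap_divisorIdeal hv hφ, support_coordPow]
  simp [Finsupp.single_apply, hr]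

/-- The centre of the divisor of `v` lies strictly inside the divisor `x = 0` of `X`. -/
lemma IsRay.one_lt_coheight_resolution {v : Fin 3 → ℚ} (hv : IsRay r a v)
    (hpos : ∀ k, 0 < v k) : 1 < Order.coheight (resolution r a hv.divisor) := by
  have he₀ : (Pi.single 0 1 : Fin 3 → ℚ) ∈ octant := ⟨0, rfl⟩
  let P := (divisorIdeal r a (Set.mem_singleton v)).comap (toChart r a hv.cone).toRingHom
  let Q := (divisorIdeal r a he₀).comap (toOctant r a).toRingHom
  have hP : P.IsPrime := Ideal.comap_isPrime _ _
  have hQ : Q.IsPrime := Ideal.comap_isPrime _ _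
  have hQ0 : coordPow r a 0 ∈ Q :=
    (coordPow_mem_comap_divisorIdeal he₀ (fun _ => rfl) 0).2 (by simp)
  have hQ1 : coordPow r a 1 ∉ Q := fun h => by
    simpa using (coordPow_mem_comap_divisorIdeal he₀ (fun _ => rfl) 1).1 h
  have hP1 : coordPow r a 1 ∈ P :=
    (coordPow_mem_comap_divisorIdeal _ (fun _ => rfl) 1).2 (hpos 1)
  have hle : Q ≤ P := fun g hg => by
    refine (mem_comap_divisorIdeal _ fun _ => rfl).2 fun m hm => ?_
    have hm0 := (mem_comap_divisorIdeal he₀ fun _ => rfl).1 hg m hm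
    refine Finset.sum_pos' (fun k _ => mul_nonneg (hpos k).le (by positivity))
      ⟨0, Finset.mem_univ _, mul_pos (hpos 0) ?_⟩
    simpa [Pi.single_apply] using hm0
  have hQbot : Q ≠ ⊥ := fun h => coordPow_ne_zero 0 (by rwa [h] at hQ0)
  have hheight := one_lt_height_of_lt hQbot (lt_of_le_of_ne hle fun h => hQ1 (h ▸ hP1))
  rwa [divisor, ← Scheme.Hom.comp_apply, chartι_resolution, ← idealHeight_eq_coheight]

variable (r a) in
/-- The generic point of the `i`-th exceptional divisor, with the generic point of the resolution
as junk value for `i` outside `[1, r)`. -/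
def divisorPoint (i : ℕ) : economicResolution r a :=
  if hi : i ∈ Set.Ico 1 r then (isRay_divisorWeight hi).divisor else genericPoint _

lemma divisorPoint_eq {i : ℕ} (hi : i ∈ Set.Ico 1 r) :
    divisorPoint r a i = (isRay_divisorWeight hi).divisor :=
  dif_pos hi

lemma injOn_divisorPoint : Set.InjOn (divisorPoint r a) (Set.Ico 1 r) := by
  intro i hi k hk hik
  have hz {i} (hi : i ∈ Set.Ico 1 r) :
      (Scheme.ord (pullbackFunction r a (coordPow r a 2)) (divisorPoint r a i) : ℚ) = i := by
    have hr : (r : ℚ) ≠ 0 := mod_cast (index_pos r a).ne'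
    rw [divisorPoint_eq hi, IsRay.ord_coordPow_divisor]
    simp [divisorWeight, hr]
  rw [← Nat.cast_inj (R := ℚ), ← hz hi, hik, hz hk]

lemma exists_divisorPoint_eq {y : economicResolution r a}
    (hy : IsExceptionalDivisor (resolution r a) y) : ∃ i ∈ Set.Ico 1 r, divisorPoint r a i = y := by
  have hoct (τ : Fan r a) (hτ : τ.1 ⊆ octant) (x) : chartι r a τ x ≠ y := by
    rintro rfl
    exact (hy.2.trans_eq ((coheight_resolution_chartι τ hτ x).trans hy.1)).false
  rcases exists_of_coheight_eq_one hy.1 with ⟨Q, hQ⟩ | ⟨v, hv, hvy⟩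
  · exact absurd hQ (hoct (Fan.zero r a) (Set.empty_subset _) Q)
  · have hmem : v ∈ raysOf (fanMax r a) := hv
    rw [raysOf_fanMax] at hmem
    rcases hmem with ⟨k, rfl⟩ | ⟨i, hi, rfl⟩
    · exact absurd hvy (hoct hv.cone (singleton_subset_octant k) _)
    · exact ⟨i, hi, (divisorPoint_eq hi).trans hvy⟩

lemma bijOn_divisorPoint : Set.BijOn (divisorPoint r a) (Set.Ico 1 r)
    {y | IsExceptionalDivisor (resolution r a) y} := by
  refine ⟨fun i hi => ?_, injOn_divisorPoint, fun y hy => exists_divisorPoint_eq hy⟩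
  rw [divisorPoint_eq hi]
  exact ⟨IsRay.coheight_divisor _, IsRay.one_lt_coheight_resolution _ (divisorWeight_pos hi)⟩

end divisors

end CyclicQuotient

end

open AlgebraicGeometry CyclicQuotient in
theorem proposition3p1 (r a : ℕ) [IsTerminalType r a] :
    ∃ E : ℕ → economicResolution r a,
      Set.BijOn E (Set.Ico 1 r) {y | IsExceptionalDivisor (resolution r a) y} ∧
      ∀ i ∈ Set.Ico 1 r,
        HasDiscrepancy (structX r a) (resolution r a) (E i) ((i : ℚ) / r) ∧
        ∀ g : invariants r a, g ≠ 0 →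
          IsLeast ((fun m : Fin 3 →₀ ℕ => ∑ j, divisorWeight r a i j * m j) '' g.1.support)
            (Scheme.ord (pullbackFunction r a g) (E i) : ℚ) := by
  refine ⟨divisorPoint r a, bijOn_divisorPoint, fun i hi => ?_⟩
  have hr : (r : ℚ) ≠ 0 := mod_cast (index_pos r a).ne'
  have hsum : ∑ k, divisorWeight r a i k - 1 = (i : ℚ) / r := by
    rw [sum_divisorWeight hi, add_sub_cancel_left]
  rw [divisorPoint_eq hi, ← hsum]
  refine ⟨IsRay.hasDiscrepancy _ (n := i) ?_, fun g hg => IsRay.isLeast_ord_divisor _ hg⟩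
  rw [hsum, mul_div_cancel₀ _ hr, Int.cast_natCast]
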